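/- Let $q,\gamma\in\mathbb{R}$ with $q\neq 0$ and $\gamma\neq 0$, and let $N\geq 1$ be an integer; if $q=-1$, assume in addition that $N\leq 2$. Let $\mathcal{O}(D_{q,\gamma})$ be the complex $*$-algebra generated by $z,z^*$ subject to the relation $z^*z-q\,zz^*=\gamma$ (the coordinate algebra of the quantum disc), with the $\mathbb{Z}_N$-grading determined by $\deg z=1$, $\deg z^*=-1$. Then the corresponding action of $\mathbb{Z}_N$ on the quantum disc is free, i.e. $\mathcal{O}(D_{q,\gamma})$ is strongly $\mathbb{Z}_N$-graded: for every $g\in\mathbb{Z}_N$ there are finitely many elements $X_i$ of degree $g$ and $Y_i$ of degree $-g$ such that $\sum_i X_iY_i=1$. Moreover, if $N>1$, the coordinate algebra $\mathcal{O}(C^N_{q,\gamma})$ of the quantum $N$-cone is homologically smooth, i.e. it has a finite-length resolution by finitely generated projective bimodules over itself. This holds for both descriptions of $\mathcal{O}(C^N_{q,\gamma})$: the degree-zero part of $\mathcal{O}(D_{q,\gamma})$, and the complex $*$-algebra generated by $a=a^*$, $b$, $b^*$ subject to $$ab=q^N ba+\gamma[N]_q b,\qquad bb^*=\prod_{l=0}^{N-1}\bigl(q^{-l}a+\gamma[-l]_q\bigr),\qquad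 b^*b=\prod_{l=1}^{N}\bigl(q^{l}a+\gamma[l]_q\bigr),$$ where $[n]_q=(1-q^n)/(1-q)$ for $q\neq 1$ and $[n]_1=n$. -/

import Mathlib

open scoped DirectSum TensorProduct

noncomputable section

universe u v

/-! ### Homological smoothness and strong gradings -/

/-- A `k`-algebra `A` is homologically smooth if, as an `A`-bimodule (that is, as a left module over
the enveloping algebra `A ⊗ Aᵐᵒᵖ`, acting by `(x ⊗ op y) • c = x * c * y`), it has a resolution of
finite length
`0 → P n → ⋯ → P 1 → P 0 → A → 0`
by finitely generated projective bimodules. -/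
def IsHomologicallySmooth (k : Type v) (A : Type u) [Field k] [Ring A] [Algebra k A] : Prop :=
  letI : Module (A ⊗[k] Aᵐᵒᵖ) A := TensorProduct.Algebra.module
  ∃ (n : ℕ) (P : ℕ → ModuleCat.{u} (A ⊗[k] Aᵐᵒᵖ))
    (d : ∀ i, P (i + 1) →ₗ[A ⊗[k] Aᵐᵒᵖ] P i) (ε : P 0 →ₗ[A ⊗[k] Aᵐᵒᵖ] A),
    (∀ i, Module.Finite (A ⊗[k] Aᵐᵒᵖ) (P i)) ∧
    (∀ i, Module.Projective (A ⊗[k] Aᵐᵒᵖ) (P i)) ∧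
    (∀ i, n < i → Subsingleton (P i)) ∧
    Function.Surjective ε ∧
    Function.Exact (d 0) ε ∧
    ∀ i, Function.Exact (d (i + 1)) (d i)

/-- A `G`-graded algebra (with the group `G` written additively) is strongly graded if for every
`g : G` there are finitely many `X i` of degree `g` and `Y i` of degree `-g` with
`∑ i, X i * Y i = 1`. This is the meaning of freeness of the corresponding action. -/
def IsStronglyGraded {k : Type v} {A : Type u} {G : Type*} [Field k] [Ring A] [Algebra k A]
    [AddCommGroup G] [DecidableEq G] (𝒜 : G → Submodule k A) [GradedAlgebra 𝒜] : Prop :=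
  ∀ g : G, ∃ (m : ℕ) (X Y : Fin m → A),
    (∀ i, X i ∈ 𝒜 g) ∧ (∀ i, Y i ∈ 𝒜 (-g)) ∧ ∑ i, X i * Y i = 1

/-! ### The quantum disc -/

/-- The two generators `z` and `z^*`. -/
inductive DiscGen : Type
  | z
  | zStar

/-- The defining relation `z^* z - q z z^* = γ`, written as `z^* z = q z z^* + γ`. It is invariant under the conjugate-linear
anti-automorphism exchanging `z` and `z^*`, so that no further relation is needed for the
`*`-algebra. -/
inductive DiscRel (q γ : ℝ) : FreeAlgebra ℂ DiscGen → FreeAlgebra ℂ DiscGen → Prop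
  | rel : DiscRel q γ
      (FreeAlgebra.ι ℂ DiscGen.zStar * FreeAlgebra.ι ℂ DiscGen.z)
      ((q : ℂ) • (FreeAlgebra.ι ℂ DiscGen.z * FreeAlgebra.ι ℂ DiscGen.zStar)
        + algebraMap ℂ (FreeAlgebra ℂ DiscGen) (γ : ℂ))

/-- The coordinate algebra of the quantum disc. -/
abbrev QuantumDisc (q γ : ℝ) : Type := RingQuot (DiscRel q γ)

namespace QuantumDisc

variable (q γ : ℝ)

/-- The image of a generator in the quantum disc algebra. -/
def gen (x : DiscGen) : QuantumDisc q γ :=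
  RingQuot.mkAlgHom ℂ (DiscRel q γ) (FreeAlgebra.ι ℂ x)

/-- The degree of a generator: `deg z = 1`, `deg z^* = -1` in `ℤ/N`. -/
def genDeg (N : ℕ) : DiscGen → ZMod N
  | DiscGen.z => 1
  | DiscGen.zStar => -1

/-- The homogeneous component of degree `i` of the `ℤ/N`-grading: the linear span of all words in
the generators whose letters have degrees adding up to `i`. -/
def grading (N : ℕ) (i : ZMod N) : Submodule ℂ (QuantumDisc q γ) :=
  Submodule.span ℂ {x | ∃ w : List DiscGen, (w.map (genDeg N)).sum = i ∧
    x = (w.map (gen q γ)).prod}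

theorem gen_rel : gen q γ DiscGen.zStar * gen q γ DiscGen.z
    = (q : ℂ) • (gen q γ DiscGen.z * gen q γ DiscGen.zStar)
      + algebraMap ℂ (QuantumDisc q γ) (γ : ℂ) := by
  have h := RingQuot.mkAlgHom_rel ℂ (DiscRel.rel (q := q) (γ := γ))
  rwa [map_mul, map_add, map_smul, map_mul, AlgHom.commutes] at h

theorem gen_mem (N : ℕ) (x : DiscGen) : gen q γ x ∈ grading q γ N (genDeg N x) :=
  Submodule.subset_span ⟨[x], by simp, by simp⟩

instance gradedMonoid (N : ℕ) : SetLike.GradedMonoid (grading q γ N) where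
  one_mem := Submodule.subset_span ⟨[], by simp, by simp⟩
  mul_mem i j x y hx hy := by
    have h : grading q γ N i * grading q γ N j ≤ grading q γ N (i + j) := by
      unfold grading
      rw [Submodule.span_mul_span, Submodule.span_le]
      rintro _ ⟨_, ⟨v, hv, rfl⟩, _, ⟨w, hw, rfl⟩, rfl⟩
      exact Submodule.subset_span ⟨v ++ w, by simp [hv, hw], by simp⟩
    exact h (Submodule.mul_mem_mul hx hy)

/-- A generator, as an element of the direct sum of the homogeneous components. -/
def genSum (N : ℕ) (x : DiscGen) : ⨁ i, grading q γ N i :=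
  DirectSum.of (fun i => grading q γ N i) (genDeg N x) ⟨gen q γ x, gen_mem q γ N x⟩

theorem genSum_mul (N : ℕ) (x y : DiscGen) (h : genDeg N x + genDeg N y = 0)
    (hm : gen q γ x * gen q γ y ∈ grading q γ N 0) :
    genSum q γ N x * genSum q γ N y =
      DirectSum.of (fun i => grading q γ N i) 0 ⟨gen q γ x * gen q γ y, hm⟩ := by
  unfold genSum
  rw [DirectSum.of_mul_of]
  exact DirectSum.of_eq_of_gradedMonoid_eq (Sigma.subtype_ext h rfl)

/-- The decomposition of an element into its homogeneous components. -/
def decomposeHom (N : ℕ) : QuantumDisc q γ →ₐ[ℂ] ⨁ i, grading q γ N i :=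
  RingQuot.liftAlgHom ℂ ⟨FreeAlgebra.lift ℂ (genSum q γ N), by
    rintro _ _ ⟨⟩
    have h₁ : genDeg N DiscGen.zStar + genDeg N DiscGen.z = 0 := by simp [genDeg]
    have h₂ : genDeg N DiscGen.z + genDeg N DiscGen.zStar = 0 := by simp [genDeg]
    have m₁ : gen q γ DiscGen.zStar * gen q γ DiscGen.z ∈ grading q γ N 0 :=
      h₁ ▸ SetLike.mul_mem_graded (gen_mem q γ N _) (gen_mem q γ N _)
    have m₂ : gen q γ DiscGen.z * gen q γ DiscGen.zStar ∈ grading q γ N 0 :=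
      h₂ ▸ SetLike.mul_mem_graded (gen_mem q γ N _) (gen_mem q γ N _)
    rw [map_mul, map_add, map_smul, map_mul, AlgHom.commutes, FreeAlgebra.lift_ι_apply,
      FreeAlgebra.lift_ι_apply]
    rw [genSum_mul q γ N _ _ h₁ m₁, genSum_mul q γ N _ _ h₂ m₂, DirectSum.algebraMap_apply]
    let L := DirectSum.lof ℂ (ZMod N) (fun i => grading q γ N i) 0
    change L _ = (q : ℂ) • L _ + L _
    rw [← map_smul, ← map_add]
    exact congrArg L (Subtype.ext (gen_rel q γ))⟩

theorem decomposeHom_gen (N : ℕ) (x : DiscGen) :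
    decomposeHom q γ N (gen q γ x) = genSum q γ N x := by
  unfold decomposeHom gen
  rw [RingQuot.liftAlgHom_mkAlgHom_apply, FreeAlgebra.lift_ι_apply]

theorem decomposeHom_word (N : ℕ) (w : List DiscGen)
    (hm : (w.map (gen q γ)).prod ∈ grading q γ N (w.map (genDeg N)).sum) :
    decomposeHom q γ N (w.map (gen q γ)).prod =
      DirectSum.of (fun i => grading q γ N i) (w.map (genDeg N)).sum
        ⟨(w.map (gen q γ)).prod, hm⟩ := by
  induction w with
  | nil =>
    simp only [List.map_nil, List.prod_nil, map_one]
    rfl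
  | cons x w ih =>
    have hw : (w.map (gen q γ)).prod ∈ grading q γ N (w.map (genDeg N)).sum :=
      Submodule.subset_span ⟨w, rfl, rfl⟩
    simp only [List.map_cons, List.prod_cons, map_mul]
    rw [ih hw, decomposeHom_gen, genSum, DirectSum.of_mul_of]
    exact DirectSum.of_eq_of_gradedMonoid_eq (Sigma.subtype_ext List.sum_cons.symm List.prod_cons.symm)

theorem decomposeHom_coe (N : ℕ) (i : ZMod N) (x : grading q γ N i) :
    decomposeHom q γ N (x : QuantumDisc q γ) =
      DirectSum.of (fun i => grading q γ N i) i x := by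
  obtain ⟨x, hx⟩ := x
  have key : ∀ y (hy : y ∈ grading q γ N i), decomposeHom q γ N y =
      DirectSum.lof ℂ (ZMod N) (fun i => grading q γ N i) i ⟨y, hy⟩ := by
    intro y hy
    refine Submodule.span_induction
      (p := fun y hy => decomposeHom q γ N y =
        DirectSum.lof ℂ (ZMod N) (fun i => grading q γ N i) i ⟨y, hy⟩) ?_ ?_ ?_ ?_ hy
    · rintro _ ⟨w, rfl, rfl⟩
      exact decomposeHom_word q γ N w _
    · rw [map_zero]
      exact (map_zero _).symm
    · intro a b ha hb h₁ h₂
      rw [map_add, h₁, h₂, ← map_add]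
      rfl
    · intro c a ha h₁
      rw [map_smul, h₁, ← map_smul]
      rfl
  exact key x hx

/-- The components `grading q γ N i` form a `ℤ/N`-grading of the quantum disc algebra. -/
instance gradedAlgebra (N : ℕ) : GradedAlgebra (grading q γ N) :=
  GradedAlgebra.ofAlgHom (grading q γ N) (decomposeHom q γ N)
    (by
      apply RingQuot.ringQuot_ext'
      apply FreeAlgebra.hom_ext
      funext x
      change DirectSum.coeAlgHom (grading q γ N) (decomposeHom q γ N (gen q γ x)) = gen q γ x
      rw [decomposeHom_gen, genSum, DirectSum.coeAlgHom_of])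
    (decomposeHom_coe q γ N)

/-- The degree-zero part of the quantum disc algebra, i.e. the fixed points of the action of the
cyclic group of order `N`. -/
abbrev degreeZero (N : ℕ) : Subalgebra ℂ (QuantumDisc q γ) :=
  SetLike.GradeZero.subalgebra (grading q γ N)

end QuantumDisc

/-! ### The quantum cone -/

/-- The `q`-integer `[n]_q = (1 - q ^ n) / (1 - q)`, with its limiting value `[n]_1 = n`. -/
def qInt (q : ℝ) (n : ℤ) : ℝ := if q = 1 then n else (1 - q ^ n) / (1 - q)

/-- The generators `a`, `b` and `b^*`. -/
inductive ConeGen : Type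
  | a
  | b
  | bStar

/-- The linear factor `q ^ l X + γ [l]_q`. -/
def coneFactor (q γ : ℝ) (l : ℤ) : Polynomial ℂ :=
  Polynomial.C ((q ^ l : ℝ) : ℂ) * Polynomial.X + Polynomial.C ((γ * qInt q l : ℝ) : ℂ)

/-- The defining relations of the quantum `N`-cone, namely
`a b = q ^ N b a + γ [N]_q b`, its adjoint `b^* a = q ^ N a b^* + γ [N]_q b^*`,
`b b^* = ∏ l = 0, …, N - 1, (q ^ (-l) a + γ [-l]_q)` and
`b^* b = ∏ l = 1, …, N, (q ^ l a + γ [l]_q)`; the last two are self-adjoint. -/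
inductive ConeRel (N : ℕ) (q γ : ℝ) : FreeAlgebra ℂ ConeGen → FreeAlgebra ℂ ConeGen → Prop
  | a_b : ConeRel N q γ
      (FreeAlgebra.ι ℂ ConeGen.a * FreeAlgebra.ι ℂ ConeGen.b)
      (((q ^ N : ℝ) : ℂ) • (FreeAlgebra.ι ℂ ConeGen.b * FreeAlgebra.ι ℂ ConeGen.a)
        + ((γ * qInt q N : ℝ) : ℂ) • FreeAlgebra.ι ℂ ConeGen.b)
  | bStar_a : ConeRel N q γ
      (FreeAlgebra.ι ℂ ConeGen.bStar * FreeAlgebra.ι ℂ ConeGen.a)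
      (((q ^ N : ℝ) : ℂ) • (FreeAlgebra.ι ℂ ConeGen.a * FreeAlgebra.ι ℂ ConeGen.bStar)
        + ((γ * qInt q N : ℝ) : ℂ) • FreeAlgebra.ι ℂ ConeGen.bStar)
  | b_bStar : ConeRel N q γ
      (FreeAlgebra.ι ℂ ConeGen.b * FreeAlgebra.ι ℂ ConeGen.bStar)
      (Polynomial.aeval (FreeAlgebra.ι ℂ ConeGen.a)
        (∏ l ∈ Finset.range N, coneFactor q γ (-(l : ℤ))))
  | bStar_b : ConeRel N q γ
      (FreeAlgebra.ι ℂ ConeGen.bStar * FreeAlgebra.ι ℂ ConeGen.b)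
      (Polynomial.aeval (FreeAlgebra.ι ℂ ConeGen.a)
        (∏ l ∈ Finset.Icc 1 N, coneFactor q γ (l : ℤ)))

/-- The coordinate algebra of the quantum `N`-cone, by generators and relations. -/
abbrev QuantumCone (N : ℕ) (q γ : ℝ) : Type := RingQuot (ConeRel N q γ)

end

noncomputable section

universe u v

open MulOpposite Polynomial

/-! Write D for the disc algebra, w for z^*, x = z w, and B for the degree-zero part.

Freeness: commuting x past powers of z and w turns z^n w^n and w^(N-n) z^(N-n) into products of
linear polynomials in x, with indices 0, -1, …, -(n-1) and 1, …, N-n respectively. Two such factors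
with indices -l and m are coprime exactly when their roots differ. For q = 1 this is automatic, and
otherwise it means q^(l+m) ≠ 1. Since 0 < l + m < N and q is real, only q = -1 could fail, and N ≤ 2
excludes that. A Bézout identity between the two products is the required decomposition of 1
(`isStronglyGraded_grading`).

Smoothness: D has a Koszul bimodule resolution 0 → D^e → D^e ⊕ D^e → D^e → D. The normally ordered
basis z^i w^j identifies D^e with polynomials in two variables over D, where exactness becomes
division by monic linear polynomials (`koszul_exact`). Grade D^e by total degree. The differentials
are homogeneous, so the strand ending in total degree 0 is again exact, and it resolves B. Its terms
are direct summands of D^e as B-bimodules. Strong grading makes D finitely generated projective over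
B on each side, hence D^e is so over B^e (`IsStronglyGraded.enveloping_projective`).

Both descriptions of the cone are covered by one criterion: an algebra embedded in D with image
exactly B. For the presented algebra, a ↦ x, b ↦ z^N, b^* ↦ w^N is such an embedding. Injectivity
comes from the spanning set f(a) b^n, f(a) (b^*)^n, whose images a representation by shifts
separates (`toDisc_injective`). -/

theorem tmul_op_induction {k : Type v} {A : Type u} [Field k] [Ring A] [Algebra k A]
    {p : A ⊗[k] Aᵐᵒᵖ → Prop} (e : A ⊗[k] Aᵐᵒᵖ)
    (h : ∀ x y, p (x ⊗ₜ op y)) (hadd : ∀ e e', p e → p e' → p (e + e')) : p e := by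
  induction e with
  | zero => simpa using h 0 0
  | add s t hs ht => exact hadd _ _ hs ht
  | tmul x y => exact h x y.unop

/-! ### Resolutions and projectivity -/

/-- Here `ε` is only additive and its bilinearity is stated on pure tensors, so that the bimodule
structure of `A`, a local instance in the definition, stays out of the hypotheses. The resolution is
continued by zero modules. -/
theorem IsHomologicallySmooth.of_length_two {k : Type v} {A : Type u} [Field k] [Ring A]
    [Algebra k A] {P₀ P₁ P₂ : Type u}
    [AddCommGroup P₀] [Module (A ⊗[k] Aᵐᵒᵖ) P₀] [Module.Finite (A ⊗[k] Aᵐᵒᵖ) P₀]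
    [Module.Projective (A ⊗[k] Aᵐᵒᵖ) P₀]
    [AddCommGroup P₁] [Module (A ⊗[k] Aᵐᵒᵖ) P₁] [Module.Finite (A ⊗[k] Aᵐᵒᵖ) P₁]
    [Module.Projective (A ⊗[k] Aᵐᵒᵖ) P₁]
    [AddCommGroup P₂] [Module (A ⊗[k] Aᵐᵒᵖ) P₂] [Module.Finite (A ⊗[k] Aᵐᵒᵖ) P₂]
    [Module.Projective (A ⊗[k] Aᵐᵒᵖ) P₂]
    (d₁ : P₂ →ₗ[A ⊗[k] Aᵐᵒᵖ] P₁) (d₀ : P₁ →ₗ[A ⊗[k] Aᵐᵒᵖ] P₀) (ε : P₀ →+ A)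
    (hε : ∀ (x y : A) (p : P₀), ε ((x ⊗ₜ[k] op y) • p) = x * ε p * y)
    (hsurj : Function.Surjective ε) (hinj : Function.Injective d₁)
    (h₀ : Function.Exact d₀ ε) (h₁ : Function.Exact d₁ d₀) :
    IsHomologicallySmooth k A := by
  let : Module (A ⊗[k] Aᵐᵒᵖ) A := TensorProduct.Algebra.module
  let P : ℕ → ModuleCat.{u} (A ⊗[k] Aᵐᵒᵖ) := fun i => match i with
    | 0 => ModuleCat.of _ P₀
    | 1 => ModuleCat.of _ P₁
    | 2 => ModuleCat.of _ P₂
    | _ + 3 => ModuleCat.of _ PUnit.{u + 1}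
  let d : ∀ i, P (i + 1) →ₗ[A ⊗[k] Aᵐᵒᵖ] P i := fun i => match i with
    | 0 => d₀
    | 1 => d₁
    | _ + 2 => 0
  have hsmul : ∀ (s : A ⊗[k] Aᵐᵒᵖ) (p : P₀), ε (s • p) = s • ε p := by
    intro s p
    induction s using tmul_op_induction with
    | hadd s t hs ht => rw [add_smul, map_add, hs, ht, add_smul]
    | h x y => rw [hε, TensorProduct.Algebra.smul_def, op_smul_eq_mul, smul_eq_mul, mul_assoc]
  refine ⟨2, P, d, { ε with map_smul' := hsmul }, ?_, ?_, ?_, hsurj, h₀, ?_⟩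
  · rintro (_ | _ | _ | i)
    · exact inferInstanceAs (Module.Finite _ P₀)
    · exact inferInstanceAs (Module.Finite _ P₁)
    · exact inferInstanceAs (Module.Finite _ P₂)
    · exact inferInstanceAs (Module.Finite _ PUnit.{u + 1})
  · rintro (_ | _ | _ | i)
    · exact inferInstanceAs (Module.Projective _ P₀)
    · exact inferInstanceAs (Module.Projective _ P₁)
    · exact inferInstanceAs (Module.Projective _ P₂)
    · exact inferInstanceAs (Module.Projective _ PUnit.{u + 1})
  · rintro (_ | _ | _ | i) hi
    · omega
    · omega
    · omega
    · exact inferInstanceAs (Subsingleton PUnit.{u + 1})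
  · rintro (_ | _ | i)
    · exact h₁
    · intro x
      change d₁ x = 0 ↔ x ∈ Set.range (0 : PUnit.{u + 1} →ₗ[A ⊗[k] Aᵐᵒᵖ] P₂)
      rw [map_eq_zero_iff d₁ hinj]
      exact ⟨fun h => ⟨PUnit.unit, h.symm⟩, fun ⟨_, h⟩ => h.symm⟩
    · intro x
      exact ⟨fun _ => ⟨PUnit.unit, rfl⟩, fun _ => rfl⟩

theorem Module.Projective.of_dual_basis {S M n : Type*} [Ring S] [AddCommGroup M] [Module S M]
    [Finite n] (f : n → M →ₗ[S] S) (x : n → M)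
    (h : ∀ m, ∑ᶠ i, f i m • x i = m) : Module.Finite S M ∧ Module.Projective S M := by
  have := Fintype.ofFinite n
  have key : ∀ m, Fintype.linearCombination S x (LinearMap.pi f m) = m := by
    intro m
    rw [Fintype.linearCombination_apply, ← finsum_eq_sum_of_fintype]
    exact h m
  exact ⟨Module.Finite.of_surjective (Fintype.linearCombination S x) fun m => ⟨_, key m⟩,
    Module.Projective.of_split (LinearMap.pi f) (Fintype.linearCombination S x)
      (LinearMap.ext key)⟩

theorem Module.Projective.range_of_idempotent {S M : Type*} [Ring S] [AddCommGroup M] [Module S M]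
    [Module.Projective S M] (π : M →ₗ[S] M) (h : ∀ m, π (π m) = π m) :
    Module.Projective S (LinearMap.range π) :=
  Module.Projective.of_split (LinearMap.range π).subtype π.rangeRestrict (by
    ext ⟨_, m, rfl⟩
    exact h m)

/-! ### Linear maps on the enveloping algebra -/

/-- A linear map, viewed as a linear map between the opposites. -/
def LinearMap.mulOp {k A B : Type*} [CommSemiring k] [AddCommMonoid A] [Module k A]
    [AddCommMonoid B] [Module k B] (f : A →ₗ[k] B) : Aᵐᵒᵖ →ₗ[k] Bᵐᵒᵖ :=
  (opLinearEquiv k).toLinearMap ∘ₗ f ∘ₗ (opLinearEquiv k).symm.toLinearMap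

@[simp]
theorem LinearMap.mulOp_op {k A B : Type*} [CommSemiring k] [AddCommMonoid A] [Module k A]
    [AddCommMonoid B] [Module k B] (f : A →ₗ[k] B) (a : A) : f.mulOp (op a) = op (f a) := rfl

section Enveloping

variable {k : Type v} {A B : Type u} [Field k] [Ring A] [Algebra k A] [Ring B] [Algebra k B]

/-- The homomorphism of enveloping algebras induced by a homomorphism of algebras. -/
def envelopingMap (ι : B →ₐ[k] A) : B ⊗[k] Bᵐᵒᵖ →ₐ[k] A ⊗[k] Aᵐᵒᵖ :=
  Algebra.TensorProduct.map ι (AlgHom.op ι)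

@[simp]
theorem envelopingMap_tmul (ι : B →ₐ[k] A) (x y : B) :
    envelopingMap ι (x ⊗ₜ op y) = ι x ⊗ₜ op (ι y) := rfl

/-- The enveloping algebra of `A` as a bimodule over an algebra mapping to `A`. -/
abbrev envelopingModule (ι : B →ₐ[k] A) : Module (B ⊗[k] Bᵐᵒᵖ) (A ⊗[k] Aᵐᵒᵖ) :=
  Module.compHom _ (envelopingMap ι).toRingHom

/-- The multiplication map of the enveloping algebra onto the algebra. -/
def envelopingMul (k : Type v) (A : Type u) [Field k] [Ring A] [Algebra k A] :
    A ⊗[k] Aᵐᵒᵖ →ₗ[k] A :=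
  TensorProduct.lift ((LinearMap.mul k A).compl₂ (opLinearEquiv k).symm.toLinearMap)

@[simp]
theorem envelopingMul_tmul (x y : A) : envelopingMul k A (x ⊗ₜ op y) = x * y := rfl

/-- The target `C` is left free for two uses: `C = B` for the coordinate maps of a dual basis, and
`C = A` for the projections onto a total degree. -/
theorem map_mulOp_envelopingMap_mul {C : Type*} [Ring C] [Algebra k C]
    (ι : B →ₐ[k] A) (j : B →ₐ[k] C) (f f' : A →ₗ[k] C)
    (hf : ∀ b a, f (ι b * a) = j b * f a) (hf' : ∀ b a, f' (a * ι b) = f' a * j b)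
    (s : B ⊗[k] Bᵐᵒᵖ) (e : A ⊗[k] Aᵐᵒᵖ) :
    TensorProduct.map f f'.mulOp (envelopingMap ι s * e) =
      Algebra.TensorProduct.map j (AlgHom.op j) s * TensorProduct.map f f'.mulOp e := by
  induction s using tmul_op_induction with
  | hadd s t hs ht => simp only [map_add, add_mul, hs, ht]
  | h x y =>
    induction e using tmul_op_induction with
    | hadd s t hs ht => simp only [map_add, mul_add, hs, ht]
    | h a b =>
      simp [Algebra.TensorProduct.tmul_mul_tmul, ← op_mul, hf, hf', AlgHom.op]

/-- A dual basis of `A` as a left `B`-module and one as a right `B`-module tensor to a dual basis of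
`A ⊗ Aᵐᵒᵖ` over `B ⊗ Bᵐᵒᵖ`. -/
theorem enveloping_projective (ι : B →ₐ[k] A) {n n' : Type*} [Finite n] [Finite n']
    (f : n → A →ₗ[k] B) (f' : n' → A →ₗ[k] B) (x : n → A) (x' : n' → A)
    (hf : ∀ i b a, f i (ι b * a) = b * f i a) (hf' : ∀ i b a, f' i (a * ι b) = f' i a * b)
    (hx : ∀ a, ∑ᶠ i, ι (f i a) * x i = a) (hx' : ∀ a, ∑ᶠ i, x' i * ι (f' i a) = a) :
    letI := envelopingModule ι
    Module.Finite (B ⊗[k] Bᵐᵒᵖ) (A ⊗[k] Aᵐᵒᵖ) ∧ Module.Projective (B ⊗[k] Bᵐᵒᵖ) (A ⊗[k] Aᵐᵒᵖ) := by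
  let := envelopingModule ι
  have := Fintype.ofFinite n
  have := Fintype.ofFinite n'
  simp only [finsum_eq_sum_of_fintype] at hx hx'
  let F : n × n' → A ⊗[k] Aᵐᵒᵖ →ₗ[B ⊗[k] Bᵐᵒᵖ] B ⊗[k] Bᵐᵒᵖ := fun p =>
    { toFun := TensorProduct.map (f p.1) (f' p.2).mulOp
      map_add' := map_add _
      map_smul' := fun s e => by
        refine (map_mulOp_envelopingMap_mul ι (AlgHom.id k B) _ _ (hf p.1) (hf' p.2)
          s e).trans ?_
        have : Algebra.TensorProduct.map (AlgHom.id k B) (AlgHom.op (AlgHom.id k B)) s = s := by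
          induction s using tmul_op_induction with
          | hadd s t hs ht => simp only [map_add, hs, ht]
          | h x y => rfl
        rw [this]; rfl }
  refine Module.Projective.of_dual_basis F (fun p => x p.1 ⊗ₜ op (x' p.2)) fun e => ?_
  rw [finsum_eq_sum_of_fintype]
  induction e using tmul_op_induction with
  | hadd s t hs ht => simp only [map_add, add_smul, Finset.sum_add_distrib, hs, ht]
  | h a b =>
    have : ∀ p : n × n', F p (a ⊗ₜ op b) • (x p.1 ⊗ₜ[k] op (x' p.2)) =
        (ι (f p.1 a) * x p.1) ⊗ₜ op (x' p.2 * ι (f' p.2 b)) := fun p => by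
      change envelopingMap ι (f p.1 a ⊗ₜ op (f' p.2 b)) * _ = _
      rw [envelopingMap_tmul, Algebra.TensorProduct.tmul_mul_tmul, op_mul]
    have hop : ∑ i, op (x' i * ι (f' i b)) = op b := by
      conv_rhs => rw [← hx' b]
      exact (map_sum (opAddEquiv : A ≃+ Aᵐᵒᵖ) _ _).symm
    simp only [this, Fintype.sum_prod_type, ← TensorProduct.tmul_sum, ← TensorProduct.sum_tmul,
      hop, hx]

/-! ### The total grading of the enveloping algebra -/

variable {G : Type*} [AddCommGroup G] [DecidableEq G] (𝒜 : G → Submodule k A) [GradedAlgebra 𝒜]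

theorem GradedAlgebra.proj_mul_of_left_mem {a : A} {i : G} (ha : a ∈ 𝒜 i) (b : A) (s : G) :
    GradedAlgebra.proj 𝒜 s (a * b) = a * GradedAlgebra.proj 𝒜 (s - i) b := by
  have := DirectSum.coe_decompose_mul_add_of_left_mem 𝒜 (j := s - i) (b := b) ha
  rwa [add_sub_cancel] at this

theorem GradedAlgebra.proj_mul_of_right_mem {b : A} {i : G} (hb : b ∈ 𝒜 i) (a : A) (s : G) :
    GradedAlgebra.proj 𝒜 s (a * b) = GradedAlgebra.proj 𝒜 (s - i) a * b := by
  have := DirectSum.coe_decompose_mul_add_of_right_mem 𝒜 (i := s - i) (a := a) hb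
  rwa [sub_add_cancel] at this

theorem GradedAlgebra.proj_mem (i : G) (a : A) : GradedAlgebra.proj 𝒜 i a ∈ 𝒜 i :=
  SetLike.coe_mem _

theorem GradedAlgebra.proj_of_mem {i : G} {a : A} (ha : a ∈ 𝒜 i) :
    GradedAlgebra.proj 𝒜 i a = a :=
  DirectSum.decompose_of_mem_same 𝒜 ha

theorem GradedAlgebra.proj_proj (i j : G) (a : A) :
    GradedAlgebra.proj 𝒜 i (GradedAlgebra.proj 𝒜 j a) =
      if i = j then GradedAlgebra.proj 𝒜 i a else 0 := by
  split_ifs with h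
  · subst h
    exact proj_of_mem 𝒜 (proj_mem 𝒜 _ a)
  · exact DirectSum.decompose_of_mem_ne 𝒜 (proj_mem 𝒜 j a) (Ne.symm h)

variable [Fintype G]

theorem GradedAlgebra.sum_proj (a : A) : ∑ i, GradedAlgebra.proj 𝒜 i a = a := by
  classical
  conv_rhs => rw [← DirectSum.sum_support_decompose 𝒜 a]
  refine (Finset.sum_subset (Finset.subset_univ _) fun i _ hi => ?_).symm
  simpa using hi

/-- The projection of the enveloping algebra onto its part of total degree `s`. -/
def totalProj (s : G) : A ⊗[k] Aᵐᵒᵖ →ₗ[k] A ⊗[k] Aᵐᵒᵖ :=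
  ∑ g, TensorProduct.map (GradedAlgebra.proj 𝒜 g) (GradedAlgebra.proj 𝒜 (s - g)).mulOp

theorem totalProj_tmul (s : G) (x y : A) : totalProj 𝒜 s (x ⊗ₜ op y) =
    ∑ g, GradedAlgebra.proj 𝒜 g x ⊗ₜ op (GradedAlgebra.proj 𝒜 (s - g) y) := by
  simp [totalProj]

theorem totalProj_idem (s : G) (e : A ⊗[k] Aᵐᵒᵖ) :
    totalProj 𝒜 s (totalProj 𝒜 s e) = totalProj 𝒜 s e := by
  induction e using tmul_op_induction with
  | hadd s t hs ht => simp only [map_add, hs, ht]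
  | h x y =>
    simp only [totalProj_tmul, map_sum]
    refine Finset.sum_congr rfl fun g _ => ?_
    rw [Finset.sum_eq_single g]
    · rw [GradedAlgebra.proj_proj, GradedAlgebra.proj_proj, if_pos rfl, if_pos rfl]
    · intro h _ hh
      rw [GradedAlgebra.proj_proj, if_neg hh, TensorProduct.zero_tmul]
    · simp

/-- Right multiplication by a homogeneous element shifts the total degree, whichever tensor factor
the element sits in. This is what makes the Koszul differentials homogeneous. -/
theorem totalProj_mul_left {t : G} {h : A} (hh : h ∈ 𝒜 t) (s : G) (e : A ⊗[k] Aᵐᵒᵖ) :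
    totalProj 𝒜 s (e * (h ⊗ₜ 1)) = totalProj 𝒜 (s - t) e * (h ⊗ₜ 1) := by
  induction e using tmul_op_induction with
  | hadd s t hs ht => simp only [map_add, add_mul, hs, ht]
  | h x y =>
    rw [Algebra.TensorProduct.tmul_mul_tmul, mul_one]
    simp only [totalProj_tmul, Finset.sum_mul, Algebra.TensorProduct.tmul_mul_tmul, mul_one,
      GradedAlgebra.proj_mul_of_right_mem 𝒜 hh]
    conv_rhs => rw [← Equiv.sum_comp (Equiv.subRight t)]
    simp only [Equiv.subRight_apply, sub_sub_sub_cancel_right]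

theorem totalProj_mul_right {t : G} {h : A} (hh : h ∈ 𝒜 t) (s : G) (e : A ⊗[k] Aᵐᵒᵖ) :
    totalProj 𝒜 s (e * (1 ⊗ₜ op h)) = totalProj 𝒜 (s - t) e * (1 ⊗ₜ op h) := by
  induction e using tmul_op_induction with
  | hadd s t hs ht => simp only [map_add, add_mul, hs, ht]
  | h x y =>
    rw [Algebra.TensorProduct.tmul_mul_tmul, mul_one, ← op_mul, totalProj_tmul, totalProj_tmul]
    simp only [Finset.sum_mul, Algebra.TensorProduct.tmul_mul_tmul, mul_one,
      GradedAlgebra.proj_mul_of_left_mem 𝒜 hh, ← op_mul, sub_right_comm]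

theorem totalProj_envelopingMap_mul (ι : B →ₐ[k] A) (hι : ∀ b, ι b ∈ 𝒜 0) (s : G)
    (t : B ⊗[k] Bᵐᵒᵖ) (e : A ⊗[k] Aᵐᵒᵖ) :
    totalProj 𝒜 s (envelopingMap ι t * e) = envelopingMap ι t * totalProj 𝒜 s e := by
  simp only [totalProj, LinearMap.sum_apply, Finset.mul_sum]
  refine Finset.sum_congr rfl fun g _ => ?_
  refine map_mulOp_envelopingMap_mul ι ι _ _ (fun b a => ?_) (fun b a => ?_) t e
  · rw [GradedAlgebra.proj_mul_of_left_mem 𝒜 (hι b), sub_zero]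
  · rw [GradedAlgebra.proj_mul_of_right_mem 𝒜 (hι b), sub_zero]

theorem envelopingMul_totalProj (s : G) (e : A ⊗[k] Aᵐᵒᵖ) :
    envelopingMul k A (totalProj 𝒜 s e) = GradedAlgebra.proj 𝒜 s (envelopingMul k A e) := by
  induction e using tmul_op_induction with
  | hadd s t hs ht => simp only [map_add, hs, ht]
  | h x y =>
    simp only [totalProj_tmul, map_sum, envelopingMul_tmul]
    conv_rhs => rw [← GradedAlgebra.sum_proj 𝒜 x, Finset.sum_mul, map_sum]
    simp only [GradedAlgebra.proj_mul_of_left_mem 𝒜 (GradedAlgebra.proj_mem 𝒜 _ x)]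

/-- The decompositions `∑ X i * Y i = 1` give dual bases: on the left the coordinates are `a ↦ (a *
X i)₀` with basis elements `Y i`, and on the right `a ↦ (Y i * a)₀` with `X i`. For fixed `g` the
left sum recovers the component of degree `-g` and the right sum that of degree `g`. -/
theorem IsStronglyGraded.enveloping_projective (h𝒜 : IsStronglyGraded 𝒜) (ι : B →ₐ[k] A)
    (hι : Function.Injective ι) (hι₀ : ∀ b, ι b ∈ 𝒜 0) (β : A →ₗ[k] B)
    (hβ : ∀ a, ι (β a) = GradedAlgebra.proj 𝒜 0 a) :
    letI := envelopingModule ι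
    Module.Finite (B ⊗[k] Bᵐᵒᵖ) (A ⊗[k] Aᵐᵒᵖ) ∧
      Module.Projective (B ⊗[k] Bᵐᵒᵖ) (A ⊗[k] Aᵐᵒᵖ) := by
  choose m X Y hX hY hXY using h𝒜
  have hl : ∀ b a, β (ι b * a) = b * β a := fun b a => hι <| by
    rw [hβ, GradedAlgebra.proj_mul_of_left_mem 𝒜 (hι₀ b), map_mul, hβ, sub_zero]
  have hr : ∀ b a, β (a * ι b) = β a * b := fun b a => hι <| by
    rw [hβ, GradedAlgebra.proj_mul_of_right_mem 𝒜 (hι₀ b), map_mul, hβ, sub_zero]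
  refine _root_.enveloping_projective ι (n := Σ g, Fin (m g)) (n' := Σ g, Fin (m g))
    (fun i => β ∘ₗ LinearMap.mulRight k (X i.1 i.2)) (fun i => β ∘ₗ LinearMap.mulLeft k (Y i.1 i.2))
    (fun i => Y i.1 i.2) (fun i => X i.1 i.2) (fun i b a => ?_) (fun i b a => ?_)
    (fun a => ?_) (fun a => ?_)
  · simp [mul_assoc, hl]
  · simp [← mul_assoc, hr]
  · rw [finsum_eq_sum_of_fintype, Fintype.sum_sigma]
    simp only [LinearMap.comp_apply, LinearMap.mulRight_apply, hβ,
      GradedAlgebra.proj_mul_of_right_mem 𝒜 (hX _ _), mul_assoc, ← Finset.mul_sum, hXY, mul_one,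
      zero_sub]
    rw [← Equiv.sum_comp (Equiv.neg G)]
    simpa using GradedAlgebra.sum_proj 𝒜 a
  · rw [finsum_eq_sum_of_fintype, Fintype.sum_sigma]
    simp only [LinearMap.comp_apply, LinearMap.mulLeft_apply, hβ,
      GradedAlgebra.proj_mul_of_left_mem 𝒜 (hY _ _), ← mul_assoc, ← Finset.sum_mul, hXY, one_mul,
      zero_sub, neg_neg]
    exact GradedAlgebra.sum_proj 𝒜 a

end Enveloping

/-! ### Algebras given by generators and relations -/

/-- This is the tool for spanning statements: a subspace containing 1 and stable under left
multiplication by the generators contains every word. -/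
theorem RingQuot.submodule_eq_top {k X : Type*} [CommRing k]
    {r : FreeAlgebra k X → FreeAlgebra k X → Prop} (S : Submodule k (RingQuot r)) (h₁ : 1 ∈ S)
    (h : ∀ x, ∀ s ∈ S, RingQuot.mkAlgHom k r (FreeAlgebra.ι k x) * s ∈ S) : S = ⊤ := by
  rw [eq_top_iff]
  rintro y -
  obtain ⟨a, rfl⟩ := RingQuot.mkAlgHom_surjective k r y
  have key : ∀ s ∈ S, RingQuot.mkAlgHom k r a * s ∈ S := by
    induction a using FreeAlgebra.induction with
    | grade0 c =>
      intro s hs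
      rw [AlgHom.commutes, ← Algebra.smul_def]
      exact S.smul_mem _ hs
    | grade1 x => exact h x
    | mul a b ha hb =>
      intro s hs
      rw [map_mul, mul_assoc]
      exact ha _ (hb _ hs)
    | add a b ha hb =>
      intro s hs
      rw [map_add, add_mul]
      exact S.add_mem (ha _ hs) (hb _ hs)
  simpa using key 1 h₁

namespace QuantumDisc

variable {q γ : ℝ}

/-- The homomorphism out of the quantum disc algebra determined by the images of `z` and `z^*`. -/
def lift {A : Type*} [Semiring A] [Algebra ℂ A] (f : DiscGen → A)
    (h : f DiscGen.zStar * f DiscGen.z =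
      (q : ℂ) • (f DiscGen.z * f DiscGen.zStar) + algebraMap ℂ A (γ : ℂ)) :
    QuantumDisc q γ →ₐ[ℂ] A :=
  RingQuot.liftAlgHom ℂ ⟨FreeAlgebra.lift ℂ f, by
    rintro _ _ ⟨⟩
    rw [map_mul, map_add, map_smul, map_mul, AlgHom.commutes, FreeAlgebra.lift_ι_apply,
      FreeAlgebra.lift_ι_apply]
    exact h⟩

@[simp]
theorem lift_gen {A : Type*} [Semiring A] [Algebra ℂ A] (f : DiscGen → A)
    (h : f DiscGen.zStar * f DiscGen.z =
      (q : ℂ) • (f DiscGen.z * f DiscGen.zStar) + algebraMap ℂ A (γ : ℂ)) (x : DiscGen) :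
    lift (q := q) (γ := γ) f h (gen q γ x) = f x := by
  unfold lift gen
  rw [RingQuot.liftAlgHom_mkAlgHom_apply, FreeAlgebra.lift_ι_apply]

/-! ### Normally ordered monomials -/

theorem zStar_mul_z_pow (i : ℕ) : gen q γ DiscGen.zStar * gen q γ DiscGen.z ^ (i + 1) =
    (q : ℂ) ^ (i + 1) • (gen q γ DiscGen.z ^ (i + 1) * gen q γ DiscGen.zStar) +
      ((γ : ℂ) * ∑ k ∈ Finset.range (i + 1), (q : ℂ) ^ k) • gen q γ DiscGen.z ^ i := by
  induction i with
  | zero => simp [gen_rel, Algebra.algebraMap_eq_smul_one]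
  | succ i ih =>
    rw [pow_succ _ (i + 1), ← mul_assoc, ih, add_mul, smul_mul_assoc, mul_assoc, gen_rel,
      Finset.sum_range_succ _ (i + 1)]
    simp only [mul_add, mul_smul_comm, ← mul_assoc, ← pow_succ, smul_mul_assoc, smul_add,
      Algebra.algebraMap_eq_smul_one, mul_one]
    module

theorem span_normal_monomials :
    Submodule.span ℂ (Set.range fun p : ℕ × ℕ =>
      gen q γ DiscGen.z ^ p.1 * gen q γ DiscGen.zStar ^ p.2) = ⊤ := by
  refine RingQuot.submodule_eq_top _ (Submodule.subset_span ⟨(0, 0), by simp⟩) fun x s hs => ?_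
  change gen q γ x * s ∈ _
  induction hs using Submodule.span_induction with
  | zero => simp
  | add a b _ _ ha hb => rw [mul_add]; exact Submodule.add_mem _ ha hb
  | smul c a _ ha => rw [mul_smul_comm]; exact Submodule.smul_mem _ _ ha
  | mem s hs =>
    obtain ⟨⟨i, j⟩, rfl⟩ := hs
    cases x with
    | z => exact Submodule.subset_span ⟨(i + 1, j), by simp only [pow_succ', mul_assoc]⟩
    | zStar =>
      cases i with
      | zero => exact Submodule.subset_span ⟨(0, j + 1), by simp [pow_succ']⟩
      | succ i =>
        rw [← mul_assoc, zStar_mul_z_pow, add_mul, smul_mul_assoc, smul_mul_assoc, mul_assoc,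
          ← pow_succ']
        exact Submodule.add_mem _
          (Submodule.smul_mem _ _ (Submodule.subset_span ⟨(i + 1, j + 1), rfl⟩))
          (Submodule.smul_mem _ _ (Submodule.subset_span ⟨(i, j), rfl⟩))

/-- The action of the generators on sequences of polynomials, which models left multiplication
on normally ordered expressions. -/
def normalAction (q γ : ℝ) : DiscGen → Module.End ℂ (ℕ → ℂ[X])
  | DiscGen.z =>
    { toFun := fun f n => Nat.casesOn n 0 f
      map_add' := fun f g => by ext1 n; cases n <;> simp
      map_smul' := fun c f => by ext1 n; cases n <;> simp }
  | DiscGen.zStar =>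
    { toFun := fun f n => (q : ℂ) ^ n • (X * f n) +
        ((γ : ℂ) * ∑ k ∈ Finset.range (n + 1), (q : ℂ) ^ k) • f (n + 1)
      map_add' := fun f g => by
        ext1 n; simp only [Pi.add_apply, mul_add, smul_add]; abel
      map_smul' := fun c f => by
        ext1 n
        simp only [Pi.smul_apply, mul_smul_comm, RingHom.id_apply, smul_add,
          smul_comm c] }

/-- The representation of the quantum disc algebra on normally ordered expressions. -/
def normalRep (q γ : ℝ) : QuantumDisc q γ →ₐ[ℂ] Module.End ℂ (ℕ → ℂ[X]) :=
  lift (normalAction q γ) <| by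
    refine LinearMap.ext fun f => funext fun n => ?_
    cases n with
    | zero => simp [normalAction]
    | succ n =>
      simp only [normalAction, Module.End.mul_apply, LinearMap.add_apply, LinearMap.smul_apply,
        LinearMap.coe_mk, AddHom.coe_mk, Pi.add_apply, Pi.smul_apply, Module.algebraMap_end_apply,
        geom_sum_succ (n := n + 1)]
      module

/-- The sequence `f` stands for `∑ z ^ n * f n (w)` and `Pi.single 0 1` for 1, so evaluating there
reads off normal-form coefficients. This gives linear independence of the monomials `z ^ i * w ^ j`.
-/
theorem normalRep_monomial (i j n : ℕ) :
    normalRep q γ (gen q γ DiscGen.z ^ i * gen q γ DiscGen.zStar ^ j) (Pi.single 0 1) n =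
      if n = i then X ^ j else 0 := by
  have hw : ∀ j n, (normalAction q γ DiscGen.zStar ^ j) (Pi.single 0 1) n =
      if n = 0 then X ^ j else 0 := by
    intro j
    induction j with
    | zero => intro n; simp [Pi.single_apply]
    | succ j ih =>
      intro n
      rw [pow_succ', Module.End.mul_apply]
      change (q : ℂ) ^ n • (X * _) + _ • _ = _
      rw [ih, ih]
      cases n <;> simp [pow_succ']
  simp only [normalRep, map_mul, map_pow, lift_gen, Module.End.mul_apply]
  induction i generalizing n with
  | zero => simpa using hw j n
  | succ i ih =>
    rw [pow_succ', Module.End.mul_apply]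
    cases n with
    | zero => simp [normalAction]
    | succ n =>
      change ((normalAction q γ DiscGen.z) ^ i) _ n = _
      rw [ih]
      simp

end QuantumDisc

/-! ### Division by a monic linear polynomial -/

theorem Polynomial.exists_eq_X_sub_C_mul_add {R : Type*} [Ring R] (a : R) (P : R[X]) :
    ∃ (Q : R[X]) (r : R), P = (X - C a) * Q + C r := by
  nontriviality R
  refine ⟨P /ₘ (X - C a), (P %ₘ (X - C a)).coeff 0, ?_⟩
  have h := degree_modByMonic_lt P (monic_X_sub_C a)
  rw [degree_X_sub_C] at h
  rw [← eq_C_of_degree_le_zero (Nat.WithBot.lt_one_iff_le_zero.mp h), add_comm,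
    modByMonic_add_div]

/-- This is uniqueness of division with remainder by a monic polynomial, valid over noncommutative
coefficients. All exactness statements for the Koszul complex rest on it. -/
theorem Polynomial.X_sub_C_mul_add_eq_zero {R : Type*} [Ring R] {a : R} {Q : R[X]} {r : R}
    (h : (X - C a) * Q + C r = 0) : Q = 0 ∧ r = 0 := by
  nontriviality R
  have := div_modByMonic_unique (f := 0) Q (C r) (monic_X_sub_C a)
    ⟨by rw [add_comm, h], by rw [degree_X_sub_C]; exact degree_C_lt⟩
  rw [zero_divByMonic, zero_modByMonic] at this
  exact ⟨this.1.symm, C_eq_zero.mp this.2.symm⟩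

theorem Polynomial.X_sub_C_mul_eq_zero {R : Type*} [Ring R] {a : R} {Q : R[X]}
    (h : (X - C a) * Q = 0) : Q = 0 :=
  (X_sub_C_mul_add_eq_zero (r := 0) (by rw [h, C_0, add_zero])).1

/-! ### The enveloping algebra as a module of polynomials -/

theorem Polynomial.bivariate_induction {R : Type*} [Semiring R] {p : R[X][X] → Prop} (P : R[X][X])
    (hadd : ∀ P Q, p P → p Q → p (P + Q))
    (hmon : ∀ i j c, p (monomial j (monomial i c))) : p P := by
  induction P using Polynomial.induction_on' with
  | add P Q hP hQ => exact hadd _ _ hP hQ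
  | monomial j P =>
    induction P using Polynomial.induction_on' with
    | add P Q hP hQ => rw [map_add]; exact hadd _ _ hP hQ
    | monomial i c => exact hmon i j c

section Koszul

variable {k : Type v} {D : Type u} [Field k] [Ring D] [Algebra k D]

/-- The map sending `c X ^ i Y ^ j` to `z ^ i w ^ j ⊗ c`. -/
def polyToEnveloping (k : Type v) {D : Type u} [Field k] [Ring D] [Algebra k D] (z w : D) :
    D[X][X] →ₗ[k] D ⊗[k] Dᵐᵒᵖ :=
  lsum fun j => lsum fun i =>
    TensorProduct.mk k D Dᵐᵒᵖ (z ^ i * w ^ j) ∘ₗ (opLinearEquiv k).toLinearMap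

theorem polyToEnveloping_monomial (z w : D) (i j : ℕ) (c : D) :
    polyToEnveloping k z w (monomial j (monomial i c)) = (z ^ i * w ^ j) ⊗ₜ op c := by
  simp [polyToEnveloping]

theorem polyToEnveloping_C_C (z w c : D) : polyToEnveloping k z w (C (C c)) = 1 ⊗ₜ op c := by
  simpa using polyToEnveloping_monomial z w 0 0 c

/-- The coefficient sequence of an element of the enveloping algebra, computed with the help of a
linear map sending `z ^ i w ^ j` to `Y ^ j` at `i`; a left inverse of `polyToEnveloping`. -/
def envelopingToPoly (κ : D →ₗ[k] ℕ → k[X]) : D ⊗[k] Dᵐᵒᵖ →ₗ[k] ℕ → D[X] :=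
  TensorProduct.lift <| LinearMap.mk₂ k
    (fun d c n => mapAlgHom (Algebra.ofId k D) (κ d n) * C (unop c))
    (fun d d' c => by ext1 n; simp only [map_add, Pi.add_apply, add_mul])
    (fun t d c => by ext1 n; simp only [map_smul, Pi.smul_apply, smul_mul_assoc])
    (fun d c c' => by ext1 n; simp only [unop_add, map_add, Pi.add_apply, mul_add])
    (fun t d c => by ext1 n; simp only [unop_smul, Pi.smul_apply, ← smul_C, mul_smul_comm])

theorem coeff_envelopingToPoly {z w : D} {κ : D →ₗ[k] ℕ → k[X]}
    (hκ : ∀ i j n, κ (z ^ i * w ^ j) n = if n = i then X ^ j else 0) (P : D[X][X]) (n j : ℕ) :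
    (envelopingToPoly κ (polyToEnveloping k z w P) n).coeff j = (P.coeff j).coeff n := by
  induction P using Polynomial.bivariate_induction with
  | hadd P Q hP hQ => simp only [map_add, Pi.add_apply, coeff_add, hP, hQ]
  | hmon i j' c =>
    rw [polyToEnveloping_monomial]
    change (mapAlgHom (Algebra.ofId k D) (κ _ n) * C c).coeff j = _
    rw [hκ, coeff_monomial]
    by_cases hn : n = i
    · subst hn
      by_cases hj : j' = j
      · subst hj; simp
      · simp [hj, coeff_X_pow, Ne.symm hj]
    · by_cases hj : j' = j
      · simp [hn, hj, coeff_monomial, Ne.symm hn]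
      · simp [hn, hj]

/-- The coefficient of `X ^ i Y ^ j` is recovered by applying `κ` to the first tensor factor. -/
theorem polyToEnveloping_injective {z w : D} {κ : D →ₗ[k] ℕ → k[X]}
    (hκ : ∀ i j n, κ (z ^ i * w ^ j) n = if n = i then X ^ j else 0) :
    Function.Injective (polyToEnveloping k z w) := by
  rw [injective_iff_map_eq_zero]
  intro P hP
  ext j n
  rw [← coeff_envelopingToPoly hκ, hP]
  simp

theorem polyToEnveloping_surjective {z w : D}
    (hspan : Submodule.span k (Set.range fun p : ℕ × ℕ => z ^ p.1 * w ^ p.2) = ⊤) :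
    Function.Surjective (polyToEnveloping k z w) := by
  intro e
  change e ∈ LinearMap.range (polyToEnveloping k z w)
  induction e using tmul_op_induction with
  | hadd _ _ h h' => exact Submodule.add_mem _ h h'
  | h d c =>
    have hd : d ∈ Submodule.span k (Set.range fun p : ℕ × ℕ => z ^ p.1 * w ^ p.2) :=
      hspan ▸ Submodule.mem_top
    induction hd using Submodule.span_induction with
    | zero => simp
    | add a b _ _ ha hb => rw [TensorProduct.add_tmul]; exact Submodule.add_mem _ ha hb
    | smul t a _ ha => rw [← TensorProduct.smul_tmul']; exact Submodule.smul_mem _ _ ha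
    | mem s hs =>
      obtain ⟨⟨i, j⟩, rfl⟩ := hs
      exact ⟨_, polyToEnveloping_monomial z w i j c⟩

/-- Since `w` stands last in `z ^ i * w ^ j`, right multiplication by `w ⊗ 1` raises the outer
exponent. Multiplying by `1 ⊗ op a` puts `a` to the left of the coefficient because the factor is
opposite. -/
theorem polyToEnveloping_X_sub_C_mul (z w a : D) (P : D[X][X]) :
    polyToEnveloping k z w ((X - C (C a)) * P) =
      polyToEnveloping k z w P * (w ⊗ₜ 1 - 1 ⊗ₜ op a) := by
  induction P using Polynomial.bivariate_induction with
  | hadd P Q hP hQ => simp only [map_add, mul_add, add_mul, hP, hQ]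
  | hmon i j c =>
    rw [sub_mul, map_sub, X_mul_monomial, C_mul_monomial, C_mul_monomial]
    simp only [polyToEnveloping_monomial, mul_sub, Algebra.TensorProduct.tmul_mul_tmul, mul_one,
      op_mul, pow_succ, mul_assoc]

/-- The analogue for `z` is restricted to polynomials constant in the outer variable: for `j > 0`
the factor `z` would have to pass `w ^ j`. -/
theorem polyToEnveloping_C_X_sub_C_mul (z w a : D) (p : D[X]) :
    polyToEnveloping k z w (C ((X - C a) * p)) =
      polyToEnveloping k z w (C p) * (z ⊗ₜ 1 - 1 ⊗ₜ op a) := by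
  induction p using Polynomial.induction_on' with
  | add P Q hP hQ => simp only [map_add, mul_add, add_mul, hP, hQ]
  | monomial i c =>
    rw [sub_mul, map_sub, map_sub, X_mul_monomial, C_mul_monomial]
    simp only [← monomial_zero_left, polyToEnveloping_monomial, mul_sub,
      Algebra.TensorProduct.tmul_mul_tmul, mul_one, op_mul, pow_succ, pow_zero]

/-! ### The Koszul complex of `w z = q z w + γ` -/

/-- The element `x ⊗ 1 - t (1 ⊗ x)` of the enveloping algebra. -/
def twistedDiff (t : k) (x : D) : D ⊗[k] Dᵐᵒᵖ := x ⊗ₜ 1 - 1 ⊗ₜ op (t • x)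

/-- The element `1 ⊗ x - t (x ⊗ 1)` of the enveloping algebra. -/
def twistedCodiff (t : k) (x : D) : D ⊗[k] Dᵐᵒᵖ := 1 ⊗ₜ op x - (t • x) ⊗ₜ 1

/-- The mixed tensors cancel, and what remains is `u ⊗ 1 - 1 ⊗ op u` with `u = w * z - q • (z * w)`,
which is the scalar `γ`. -/
theorem koszul_comp {z w : D} {q γ : k} (hrel : w * z = q • (z * w) + algebraMap k D γ) :
    twistedDiff q w * twistedDiff (1 : k) z + twistedCodiff q z * twistedDiff (1 : k) w = 0 := by
  simp only [twistedDiff, twistedCodiff, sub_mul, mul_sub, Algebra.TensorProduct.tmul_mul_tmul,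
    mul_one, one_mul, ← op_mul, one_smul, smul_mul_assoc, hrel, op_add, op_smul,
    TensorProduct.add_tmul, TensorProduct.tmul_add, TensorProduct.tmul_smul,
    ← TensorProduct.smul_tmul', Algebra.algebraMap_eq_smul_one, op_one]
  abel

theorem koszul_injective {z w : D} {q : k} {κ : D →ₗ[k] ℕ → k[X]}
    (hspan : Submodule.span k (Set.range fun p : ℕ × ℕ => z ^ p.1 * w ^ p.2) = ⊤)
    (hκ : ∀ i j n, κ (z ^ i * w ^ j) n = if n = i then X ^ j else 0)
    {e : D ⊗[k] Dᵐᵒᵖ} (h : e * twistedDiff q w = 0) : e = 0 := by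
  obtain ⟨P, rfl⟩ := polyToEnveloping_surjective hspan e
  rw [twistedDiff, ← polyToEnveloping_X_sub_C_mul,
    map_eq_zero_iff _ (polyToEnveloping_injective hκ)] at h
  rw [X_sub_C_mul_eq_zero h, map_zero]

/-- Dividing `α` by `Y - q w` gives the quotient `e` and a remainder free of `Y`. Subtracting the
boundary of `e` leaves a relation in which uniqueness of division kills everything. -/
theorem koszul_exact {z w : D} {q γ : k} (hrel : w * z = q • (z * w) + algebraMap k D γ)
    {κ : D →ₗ[k] ℕ → k[X]}
    (hspan : Submodule.span k (Set.range fun p : ℕ × ℕ => z ^ p.1 * w ^ p.2) = ⊤)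
    (hκ : ∀ i j n, κ (z ^ i * w ^ j) n = if n = i then X ^ j else 0) {α β : D ⊗[k] Dᵐᵒᵖ}
    (h : α * twistedDiff (1 : k) z + β * twistedDiff (1 : k) w = 0) :
    ∃ e, α = e * twistedDiff q w ∧ β = e * twistedCodiff q z := by
  obtain ⟨A, rfl⟩ := polyToEnveloping_surjective hspan α
  obtain ⟨Q, p, rfl⟩ := exists_eq_X_sub_C_mul_add (C (q • w)) A
  rw [map_add, polyToEnveloping_X_sub_C_mul, ← twistedDiff, add_mul] at h
  obtain ⟨R, hR⟩ := polyToEnveloping_surjective hspan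
    (β - polyToEnveloping k z w Q * twistedCodiff q z)
  -- The cycle condition minus `koszul_comp` multiplied by the quotient: the remainder `p` of `α`
  -- and the corrected `β`, represented by `R`, again form a cycle.
  have h' : polyToEnveloping k z w ((X - C (C w)) * R + C ((X - C z) * p)) = 0 := by
    have hcomp := congrArg (polyToEnveloping k z w Q * ·) (koszul_comp hrel)
    simp only [mul_add, mul_zero, ← mul_assoc] at hcomp
    rw [map_add, polyToEnveloping_X_sub_C_mul, polyToEnveloping_C_X_sub_C_mul, hR,
      ← sub_eq_zero_of_eq (h.trans hcomp.symm)]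
    simp only [twistedDiff, one_smul, sub_mul]
    abel
  rw [map_eq_zero_iff _ (polyToEnveloping_injective hκ)] at h'
  obtain ⟨rfl, hp⟩ := X_sub_C_mul_add_eq_zero h'
  obtain rfl := X_sub_C_mul_eq_zero hp
  refine ⟨polyToEnveloping k z w Q, ?_, ?_⟩
  · rw [C_0, add_zero, polyToEnveloping_X_sub_C_mul, twistedDiff]
  · rwa [map_zero, eq_comm, sub_eq_zero] at hR

theorem envelopingMul_mul_twistedDiff (x : D) (e : D ⊗[k] Dᵐᵒᵖ) :
    envelopingMul k D (e * twistedDiff (1 : k) x) = 0 := by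
  induction e using tmul_op_induction with
  | hadd s t hs ht => simp only [map_add, add_mul, hs, ht, add_zero]
  | h a b =>
    rw [twistedDiff, one_smul, mul_sub, Algebra.TensorProduct.tmul_mul_tmul,
      Algebra.TensorProduct.tmul_mul_tmul, mul_one, mul_one, ← op_mul, map_sub,
      envelopingMul_tmul, envelopingMul_tmul, mul_assoc, sub_self]

/-- Divide by `Y - w`, then divide the remainder by `X - z`. The final remainder is `1 ⊗ op c`, and
multiplication sends it to `c`. -/
theorem exists_of_envelopingMul_eq_zero {z w : D}
    (hspan : Submodule.span k (Set.range fun p : ℕ × ℕ => z ^ p.1 * w ^ p.2) = ⊤)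
    {e : D ⊗[k] Dᵐᵒᵖ} (h : envelopingMul k D e = 0) :
    ∃ α β, e = α * twistedDiff (1 : k) z + β * twistedDiff (1 : k) w := by
  obtain ⟨P, rfl⟩ := polyToEnveloping_surjective hspan e
  obtain ⟨Q, p, rfl⟩ := exists_eq_X_sub_C_mul_add (C w) P
  obtain ⟨r, c, rfl⟩ := exists_eq_X_sub_C_mul_add z p
  have hsplit : polyToEnveloping k z w ((X - C (C w)) * Q + C ((X - C z) * r + C c)) =
      polyToEnveloping k z w (C r) * twistedDiff (1 : k) z +
      polyToEnveloping k z w Q * twistedDiff (1 : k) w + 1 ⊗ₜ op c := by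
    rw [map_add, map_add C, map_add, polyToEnveloping_X_sub_C_mul, polyToEnveloping_C_X_sub_C_mul,
      polyToEnveloping_C_C]
    simp only [twistedDiff, one_smul]
    abel
  rw [hsplit] at h ⊢
  rw [map_add, map_add, envelopingMul_mul_twistedDiff, envelopingMul_mul_twistedDiff,
    envelopingMul_tmul, one_mul, add_zero, zero_add] at h
  exact ⟨_, _, by rw [h, op_zero, TensorProduct.tmul_zero, add_zero]⟩

/-! ### Smoothness of the degree-zero part -/

/-- Exactness passes to the strand because any preimage may be replaced by its component in the
right total degree. The middle term sits in degrees `-g` and `g`, compensating for the degrees of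
`z` and `w`. -/
theorem IsStronglyGraded.isHomologicallySmooth {z w : D} {q γ : k}
    (hrel : w * z = q • (z * w) + algebraMap k D γ) {κ : D →ₗ[k] ℕ → k[X]}
    (hspan : Submodule.span k (Set.range fun p : ℕ × ℕ => z ^ p.1 * w ^ p.2) = ⊤)
    (hκ : ∀ i j n, κ (z ^ i * w ^ j) n = if n = i then X ^ j else 0)
    {G : Type*} [AddCommGroup G] [DecidableEq G] [Fintype G] (𝒜 : G → Submodule k D)
    [GradedAlgebra 𝒜] (h𝒜 : IsStronglyGraded 𝒜) {g : G} (hz : z ∈ 𝒜 g) (hw : w ∈ 𝒜 (-g))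
    {B : Type u} [Ring B] [Algebra k B] (ι : B →ₐ[k] D) (hι : Function.Injective ι)
    (hrange : ∀ d, d ∈ 𝒜 0 ↔ ∃ b, ι b = d) : IsHomologicallySmooth k B := by
  have hι₀ : ∀ b, ι b ∈ 𝒜 0 := fun b => (hrange _).2 ⟨b, rfl⟩
  obtain ⟨β, hβ⟩ : ∃ β : D →ₗ[k] B, ∀ a, ι (β a) = GradedAlgebra.proj 𝒜 0 a := by
    choose f hf using fun a => (hrange _).1 (GradedAlgebra.proj_mem 𝒜 0 a)
    exact ⟨{ toFun := f
             map_add' := fun a b => hι (by simp only [map_add, hf])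
             map_smul' := fun t a => hι (by simp only [map_smul, hf, RingHom.id_apply]) }, hf⟩
  let := envelopingModule ι
  obtain ⟨hfin, hproj⟩ := h𝒜.enveloping_projective 𝒜 ι hι hι₀ β hβ
  let π : G → D ⊗[k] Dᵐᵒᵖ →ₗ[B ⊗[k] Bᵐᵒᵖ] D ⊗[k] Dᵐᵒᵖ := fun s =>
    { toFun := totalProj 𝒜 s
      map_add' := map_add _
      map_smul' := fun t e => totalProj_envelopingMap_mul 𝒜 ι hι₀ s t e }
  have hπ : ∀ s e, π s (π s e) = π s e := totalProj_idem 𝒜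
  have hmem : ∀ s (p : LinearMap.range (π s)), π s p = p := by
    rintro s ⟨_, e, rfl⟩
    exact hπ s e
  have hprojr : ∀ s, Module.Projective (B ⊗[k] Bᵐᵒᵖ) (LinearMap.range (π s)) := fun s =>
    Module.Projective.range_of_idempotent (π s) (hπ s)
  let R : D ⊗[k] Dᵐᵒᵖ → D ⊗[k] Dᵐᵒᵖ →ₗ[B ⊗[k] Bᵐᵒᵖ] D ⊗[k] Dᵐᵒᵖ := fun x =>
    { toFun := fun e => e * x
      map_add' := fun e e' => add_mul e e' x
      map_smul' := fun t e => mul_assoc (envelopingMap ι t) e x }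
  have hdiff : ∀ {x : D} {t : G} (c : k) (_ : x ∈ 𝒜 t) (s : G) (e : D ⊗[k] Dᵐᵒᵖ),
      π s (e * twistedDiff c x) = π (s - t) e * twistedDiff c x := fun c hx s e => by
    change totalProj 𝒜 s _ = totalProj 𝒜 _ e * _
    rw [twistedDiff, mul_sub, map_sub, totalProj_mul_left 𝒜 hx,
      totalProj_mul_right 𝒜 (Submodule.smul_mem _ c hx), mul_sub]
  have hcodiff : ∀ {x : D} {t : G} (c : k) (_ : x ∈ 𝒜 t) (s : G) (e : D ⊗[k] Dᵐᵒᵖ),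
      π s (e * twistedCodiff c x) = π (s - t) e * twistedCodiff c x := fun c hx s e => by
    change totalProj 𝒜 s _ = totalProj 𝒜 _ e * _
    rw [twistedCodiff, mul_sub, map_sub, totalProj_mul_right 𝒜 hx,
      totalProj_mul_left 𝒜 (Submodule.smul_mem _ c hx), mul_sub]
  have hRmem : ∀ {s t : G} {x : D ⊗[k] Dᵐᵒᵖ}, (∀ e, π s (e * x) = π t e * x) →
      ∀ p ∈ LinearMap.range (π t), R x p ∈ LinearMap.range (π s) := by
    rintro s t x h _ ⟨e, rfl⟩
    exact ⟨e * x, h e⟩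
  have h₁z : ∀ e, π (-g) (e * twistedDiff q w) = π 0 e * twistedDiff q w := fun e => by
    rw [hdiff q hw, sub_self]
  have h₁w : ∀ e, π g (e * twistedCodiff q z) = π 0 e * twistedCodiff q z := fun e => by
    rw [hcodiff q hz, sub_self]
  have h₀z : ∀ e, π 0 (e * twistedDiff (1 : k) z) = π (-g) e * twistedDiff (1 : k) z := fun e => by
    rw [hdiff 1 hz, zero_sub]
  have h₀w : ∀ e, π 0 (e * twistedDiff (1 : k) w) = π g e * twistedDiff (1 : k) w := fun e => by
    rw [hdiff 1 hw, zero_sub, neg_neg]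
  let d₁ : LinearMap.range (π 0) →ₗ[B ⊗[k] Bᵐᵒᵖ]
      LinearMap.range (π (-g)) × LinearMap.range (π g) :=
    ((R (twistedDiff q w)).restrict (hRmem h₁z)).prod ((R (twistedCodiff q z)).restrict (hRmem h₁w))
  let d₀ : LinearMap.range (π (-g)) × LinearMap.range (π g) →ₗ[B ⊗[k] Bᵐᵒᵖ]
      LinearMap.range (π 0) :=
    ((R (twistedDiff (1 : k) z)).restrict (hRmem h₀z)).coprod
      ((R (twistedDiff (1 : k) w)).restrict (hRmem h₀w))
  let ε : LinearMap.range (π 0) →+ B :=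
    (β ∘ₗ envelopingMul k D).toAddMonoidHom.comp (LinearMap.range (π 0)).subtype.toAddMonoidHom
  have hιε : ∀ p, ι (ε p) = envelopingMul k D p := fun p => by
    change ι (β (envelopingMul k D p)) = _
    rw [hβ, ← envelopingMul_totalProj]
    exact congrArg _ (hmem 0 p)
  refine IsHomologicallySmooth.of_length_two (P₀ := LinearMap.range (π 0))
    (P₁ := LinearMap.range (π (-g)) × LinearMap.range (π g)) (P₂ := LinearMap.range (π 0)) d₁ d₀ ε ?_ ?_ ?_ ?_ ?_
  · rintro x y p
    apply hι
    rw [map_mul, map_mul, hιε, hιε]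
    change envelopingMul k D (envelopingMap ι (x ⊗ₜ op y) * p) = _
    generalize (p : D ⊗[k] Dᵐᵒᵖ) = e
    induction e using tmul_op_induction with
    | hadd s t hs ht => simp only [mul_add, map_add, add_mul, hs, ht]
    | h a b =>
      rw [envelopingMap_tmul, Algebra.TensorProduct.tmul_mul_tmul, ← op_mul, envelopingMul_tmul,
        envelopingMul_tmul]
      simp only [mul_assoc]
  · intro b
    refine ⟨⟨π 0 (ι b ⊗ₜ op 1), _, rfl⟩, hι ?_⟩
    rw [hιε]
    change envelopingMul k D (totalProj 𝒜 0 _) = _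
    rw [envelopingMul_totalProj, envelopingMul_tmul, mul_one, GradedAlgebra.proj_of_mem 𝒜 (hι₀ b)]
  · rw [injective_iff_map_eq_zero]
    intro p hp
    exact Subtype.ext (koszul_injective hspan hκ (q := q)
      (congrArg (fun x => (x.1 : D ⊗[k] Dᵐᵒᵖ)) hp))
  · intro p
    constructor
    · intro hp
      have hp' := hιε p
      rw [hp, map_zero] at hp'
      obtain ⟨α, β', h⟩ := exists_of_envelopingMul_eq_zero hspan hp'.symm
      refine ⟨(⟨π (-g) α, _, rfl⟩, ⟨π g β', _, rfl⟩), Subtype.ext ?_⟩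
      change π (-g) α * twistedDiff (1 : k) z + π g β' * twistedDiff (1 : k) w = p
      rw [← h₀z, ← h₀w, ← map_add, ← h, hmem]
    · rintro ⟨⟨a, b⟩, rfl⟩
      apply hι
      rw [hιε, map_zero]
      change envelopingMul k D ((a : D ⊗[k] Dᵐᵒᵖ) * twistedDiff (1 : k) z +
        b * twistedDiff (1 : k) w) = 0
      rw [map_add, envelopingMul_mul_twistedDiff, envelopingMul_mul_twistedDiff, add_zero]
  · rintro ⟨a, b⟩
    constructor
    · intro h
      obtain ⟨e, ha, hb⟩ := koszul_exact hrel hspan hκ (α := a) (β := b) (congrArg Subtype.val h)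
      refine ⟨⟨π 0 e, _, rfl⟩, Prod.ext (Subtype.ext ?_) (Subtype.ext ?_)⟩
      · change π 0 e * twistedDiff q w = a
        rw [← h₁z, ← ha, hmem]
      · change π 0 e * twistedCodiff q z = b
        rw [← h₁w, ← hb, hmem]
    · rintro ⟨e, he⟩
      rw [← he]
      apply Subtype.ext
      change (e : D ⊗[k] Dᵐᵒᵖ) * twistedDiff q w * twistedDiff (1 : k) z +
        e * twistedCodiff q z * twistedDiff (1 : k) w = 0
      rw [mul_assoc, mul_assoc, ← mul_add, koszul_comp hrel, mul_zero]

end Koszul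

/-! ### `q`-integers and linear factors -/

theorem qInt_add_one {q : ℝ} (hq : q ≠ 0) (l : ℤ) : qInt q (l + 1) = q * qInt q l + 1 := by
  unfold qInt
  split_ifs with h
  · subst h; push_cast; ring
  · have : 1 - q ≠ 0 := sub_ne_zero.mpr (Ne.symm h)
    rw [zpow_add_one₀ hq]
    field_simp
    ring

theorem qInt_add_one' {q : ℝ} (hq : q ≠ 0) (l : ℤ) : qInt q (l + 1) = qInt q l + q ^ l := by
  unfold qInt
  split_ifs with h
  · subst h; push_cast; simp
  · have : 1 - q ≠ 0 := sub_ne_zero.mpr (Ne.symm h)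
    rw [zpow_add_one₀ hq]
    field_simp
    ring

theorem qInt_zero (q : ℝ) : qInt q 0 = 0 := by simp [qInt]

theorem coneFactor_zero (q γ : ℝ) : coneFactor q γ 0 = X := by
  simp [coneFactor, qInt_zero]

theorem coneFactor_add_one {q : ℝ} (hq : q ≠ 0) (γ : ℝ) (l : ℤ) :
    coneFactor q γ (l + 1) = C (q : ℂ) * coneFactor q γ l + C (γ : ℂ) := by
  rw [coneFactor, coneFactor, qInt_add_one hq, zpow_add_one₀ hq]
  simp only [Complex.ofReal_mul, Complex.ofReal_add, Complex.ofReal_one, C_mul, C_add, C_1]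
  ring

theorem coneFactor_sub_one {q : ℝ} (hq : q ≠ 0) (γ : ℝ) (l : ℤ) :
    coneFactor q γ (l - 1) = C (q : ℂ)⁻¹ * coneFactor q γ l + C (-(γ : ℂ) * (q : ℂ)⁻¹) := by
  have h := coneFactor_add_one hq γ (l - 1)
  have hc : C (q : ℂ)⁻¹ * C (q : ℂ) = 1 := by
    rw [← C_mul, inv_mul_cancel₀ (Complex.ofReal_ne_zero.mpr hq), C_1]
  rw [sub_add_cancel] at h
  rw [h, C_mul, C_neg]
  linear_combination (-coneFactor q γ (l - 1)) * hc

theorem natDegree_coneFactor {q : ℝ} (hq : q ≠ 0) (γ : ℝ) (l : ℤ) :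
    (coneFactor q γ l).natDegree = 1 :=
  natDegree_linear (Complex.ofReal_ne_zero.mpr (zpow_ne_zero l hq))

theorem coneFactor_ne_zero {q : ℝ} (hq : q ≠ 0) (γ : ℝ) (l : ℤ) : coneFactor q γ l ≠ 0 :=
  ne_zero_of_natDegree_gt (n := 0) (by rw [natDegree_coneFactor hq]; exact one_pos)

/-- The combination `q ^ l * coneFactor m - q ^ m * coneFactor l` eliminates `X` and leaves the
scalar `u`, nonzero by hypothesis. -/
theorem isCoprime_coneFactor {q γ : ℝ} (hγ : γ ≠ 0) {l m : ℤ}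
    (h : q ^ l * qInt q m ≠ q ^ m * qInt q l) :
    IsCoprime (coneFactor q γ l) (coneFactor q γ m) := by
  have hu : ((γ * (q ^ l * qInt q m - q ^ m * qInt q l) : ℝ) : ℂ) ≠ 0 :=
    Complex.ofReal_ne_zero.mpr (mul_ne_zero hγ (sub_ne_zero.mpr h))
  set u := ((γ * (q ^ l * qInt q m - q ^ m * qInt q l) : ℝ) : ℂ) with hu'
  refine ⟨C (-(u⁻¹ * (q ^ m : ℝ))), C (u⁻¹ * (q ^ l : ℝ)), ?_⟩
  have : C u⁻¹ * C u = (1 : ℂ[X]) := by rw [← C_mul, inv_mul_cancel₀ hu, C_1]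
  rw [← this, hu', coneFactor, coneFactor]
  simp only [Complex.ofReal_mul, Complex.ofReal_sub, C_mul, C_neg, C_sub]
  ring

theorem qInt_cross_ne {q : ℝ} (hq : q ≠ 0) {N : ℕ} (hq' : q = -1 → N ≤ 2) {l m : ℕ} (hm : 1 ≤ m)
    (hlm : l + m < N) : q ^ (-(l : ℤ)) * qInt q m ≠ q ^ (m : ℤ) * qInt q (-(l : ℤ)) := by
  intro h
  unfold qInt at h
  split_ifs at h with h₁
  · subst h₁
    simp only [one_zpow, one_mul] at h
    have : (m : ℤ) = -(l : ℤ) := by exact_mod_cast h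
    omega
  · have h₂ : 1 - q ≠ 0 := sub_ne_zero.mpr (Ne.symm h₁)
    rw [← mul_div_assoc, ← mul_div_assoc, div_left_inj' h₂, zpow_neg, zpow_natCast,
      zpow_natCast] at h
    have hl : q ^ l ≠ 0 := pow_ne_zero l hq
    field_simp at h
    -- Equality of the cross terms makes `q` a real root of unity of order dividing `l + m`, so only
    -- 1 and -1 are candidates.
    have h₃ : q ^ (l + m) = 1 := by rw [pow_add]; linarith
    rcases pow_eq_one_iff_cases.mp h₃ with h | h | ⟨h, heven⟩
    · omega
    · exact h₁ h
    · have := hq' h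
      obtain ⟨r, hr⟩ := heven
      omega

/-! ### Elements of generalized Weyl algebras -/

section Weyl

variable {k A : Type*} [Field k] [Semiring A] [Algebra k A]

theorem mul_aeval_of_mul_eq {a a' b : A} (h : b * a = a' * b) (f : k[X]) :
    b * aeval a f = aeval a' f * b := by
  have hp : ∀ n : ℕ, b * a ^ n = a' ^ n * b := fun n => SemiconjBy.pow_right h n
  induction f using Polynomial.induction_on' with
  | add f g hf hg => rw [map_add, map_add, mul_add, add_mul, hf, hg]
  | monomial n c =>
    rw [aeval_monomial, aeval_monomial, ← Algebra.smul_def, ← Algebra.smul_def, mul_smul_comm, hp,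
      smul_mul_assoc]

theorem mul_aeval_of_mul_eq_aeval {a b : A} {s : k[X]} (h : b * a = aeval a s * b) (f : k[X]) :
    b * aeval a f = aeval a (f.comp s) * b := by
  rw [mul_aeval_of_mul_eq h, aeval_comp]

/-- The power `b ^ n` for `n ≥ 0` and `c ^ (-n)` for `n < 0`. -/
def weylPower (b c : A) : ℤ → A
  | Int.ofNat n => b ^ n
  | Int.negSucc n => c ^ (n + 1)

theorem weylPower_mul (b c : A) (N : ℕ) (n : ℤ) (hN : 1 ≤ N) :
    weylPower b c (N * n) = weylPower (b ^ N) (c ^ N) n := by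
  cases n with
  | ofNat n =>
    have : (N : ℤ) * Int.ofNat n = Int.ofNat (N * n) := by simp
    rw [this]
    exact pow_mul b N n
  | negSucc n =>
    obtain ⟨r, hr⟩ : ∃ r, N * (n + 1) = r + 1 := ⟨N * (n + 1) - 1, by
      have : 1 ≤ N * (n + 1) := Nat.mul_pos hN n.succ_pos
      omega⟩
    have : (N : ℤ) * Int.negSucc n = Int.negSucc r := by
      rw [Int.negSucc_eq, Int.negSucc_eq, mul_neg]
      exact_mod_cast congrArg (fun x : ℕ => -(x : ℤ)) hr
    rw [this]
    change c ^ (r + 1) = (c ^ N) ^ (n + 1)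
    rw [← hr, pow_mul]

theorem mul_weylPower {a b c : A} {p : k[X]} (hbc : b * c = aeval a p) (n : ℤ) :
    ∃ f : k[X], b * weylPower b c n = aeval a f * weylPower b c (n + 1) := by
  cases n with
  | ofNat n => exact ⟨1, by rw [map_one, one_mul]; exact (pow_succ' b n).symm⟩
  | negSucc n =>
    refine ⟨p, ?_⟩
    change b * c ^ (n + 1) = _
    rw [pow_succ', ← mul_assoc, hbc]
    cases n with
    | zero => simp [weylPower]
    | succ n => rfl

theorem mul_weylPower' {a b c : A} {r : k[X]} (hcb : c * b = aeval a r) (n : ℤ) :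
    ∃ f : k[X], c * weylPower b c n = aeval a f * weylPower b c (n - 1) := by
  cases n with
  | ofNat n =>
    cases n with
    | zero =>
      refine ⟨1, ?_⟩
      rw [map_one, one_mul]
      change c * b ^ 0 = c ^ (0 + 1)
      rw [pow_zero, mul_one, zero_add, pow_one]
    | succ n =>
      refine ⟨r, ?_⟩
      have : Int.ofNat (n + 1) - 1 = Int.ofNat n := by simp
      rw [this]
      change c * b ^ (n + 1) = aeval a r * b ^ n
      rw [pow_succ', ← mul_assoc, hcb]
  | negSucc n => exact ⟨1, by rw [map_one, one_mul]; exact (pow_succ' c (n + 1)).symm⟩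

theorem mul_aeval_mul_weylPower {a b c : A} {p s : k[X]} (hbc : b * c = aeval a p)
    (hb : b * a = aeval a s * b) (f : k[X]) (n : ℤ) :
    ∃ g : k[X], b * (aeval a f * weylPower b c n) = aeval a g * weylPower b c (n + 1) := by
  obtain ⟨g, hg⟩ := mul_weylPower hbc n
  exact ⟨f.comp s * g, by
    rw [← mul_assoc, mul_aeval_of_mul_eq_aeval hb, mul_assoc, hg, map_mul, mul_assoc]⟩

theorem mul_aeval_mul_weylPower' {a b c : A} {r t : k[X]} (hcb : c * b = aeval a r)
    (hc : c * a = aeval a t * c) (f : k[X]) (n : ℤ) :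
    ∃ g : k[X], c * (aeval a f * weylPower b c n) = aeval a g * weylPower b c (n - 1) := by
  obtain ⟨g, hg⟩ := mul_weylPower' hcb n
  exact ⟨f.comp t * g, by
    rw [← mul_assoc, mul_aeval_of_mul_eq_aeval hc, mul_assoc, hg, map_mul, mul_assoc]⟩

theorem map_weylPower {A' : Type*} [Semiring A'] [Algebra k A'] (φ : A →ₐ[k] A') (b c : A) (n : ℤ) :
    φ (weylPower b c n) = weylPower (φ b) (φ c) n := by
  cases n <;> simp [weylPower]

/-- The linear map sending a finitely supported family `f` of polynomials to
`∑ n, f n (a) * weylPower b c n`. -/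
def weylSum (k : Type*) {A : Type*} [Field k] [Semiring A] [Algebra k A] (a b c : A) :
    (ℤ →₀ k[X]) →ₗ[k] A :=
  Finsupp.lsum k fun n => LinearMap.mulRight k (weylPower b c n) ∘ₗ (aeval a).toLinearMap

theorem weylSum_single (a b c : A) (n : ℤ) (f : k[X]) :
    weylSum k a b c (Finsupp.single n f) = aeval a f * weylPower b c n := by
  simp [weylSum]

theorem mul_mem_range_weylSum {a b c y : A}
    (h : ∀ (f : k[X]) n, ∃ (g : k[X]) (m : ℤ),
      y * (aeval a f * weylPower b c n) = aeval a g * weylPower b c m)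
    {s : A} (hs : s ∈ LinearMap.range (weylSum k a b c)) :
    y * s ∈ LinearMap.range (weylSum k a b c) := by
  obtain ⟨F, rfl⟩ := hs
  induction F using Finsupp.induction_linear with
  | zero => simp
  | add F G hF hG => rw [map_add, mul_add]; exact Submodule.add_mem _ hF hG
  | single n f =>
    obtain ⟨g, m, hg⟩ := h f n
    rw [weylSum_single, hg]
    exact ⟨_, weylSum_single a b c m g⟩

end Weyl

namespace QuantumDisc

variable {q γ : ℝ}

local notation "𝐳" => gen q γ DiscGen.z
local notation "𝐰" => gen q γ DiscGen.zStar

/-! ### The generalized Weyl structure of the quantum disc -/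

theorem aeval_coneFactor_add_one (hq : q ≠ 0) (l : ℤ) :
    aeval (𝐳 * 𝐰) (coneFactor q γ (l + 1)) =
      (q : ℂ) • aeval (𝐳 * 𝐰) (coneFactor q γ l) + (γ : ℂ) • 1 := by
  rw [coneFactor_add_one hq, map_add, map_mul, aeval_C, aeval_C, ← Algebra.smul_def,
    Algebra.algebraMap_eq_smul_one]

theorem aeval_coneFactor_sub_one (hq : q ≠ 0) (l : ℤ) :
    aeval (𝐳 * 𝐰) (coneFactor q γ (l - 1)) =
      (q : ℂ)⁻¹ • aeval (𝐳 * 𝐰) (coneFactor q γ l) + (-(γ : ℂ) * (q : ℂ)⁻¹) • 1 := by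
  rw [coneFactor_sub_one hq, map_add, map_mul, aeval_C, aeval_C, ← Algebra.smul_def,
    Algebra.algebraMap_eq_smul_one (-(γ : ℂ) * (q : ℂ)⁻¹)]

theorem zStar_mul_z (hq : q ≠ 0) : 𝐰 * 𝐳 = aeval (𝐳 * 𝐰) (coneFactor q γ 1) := by
  have h := aeval_coneFactor_add_one (γ := γ) hq 0
  rw [zero_add, coneFactor_zero, aeval_X] at h
  rw [h, gen_rel, Algebra.algebraMap_eq_smul_one]

theorem zStar_mul_x (hq : q ≠ 0) :
    𝐰 * (𝐳 * 𝐰) = aeval (𝐳 * 𝐰) (coneFactor q γ 1) * 𝐰 := by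
  rw [← mul_assoc, zStar_mul_z hq]

theorem x_mul_z : 𝐳 * 𝐰 * 𝐳 = (q : ℂ) • (𝐳 * (𝐳 * 𝐰)) + (γ : ℂ) • 𝐳 := by
  rw [mul_assoc, gen_rel, mul_add, mul_smul_comm, Algebra.algebraMap_eq_smul_one, mul_smul_comm,
    mul_one]

theorem z_mul_x (hq : q ≠ 0) :
    𝐳 * (𝐳 * 𝐰) = aeval (𝐳 * 𝐰) (coneFactor q γ (-1)) * 𝐳 := by
  have h := aeval_coneFactor_sub_one (γ := γ) hq 0
  rw [zero_sub, coneFactor_zero, aeval_X] at h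
  have hq' : (q : ℂ) ≠ 0 := Complex.ofReal_ne_zero.mpr hq
  rw [h, add_mul, smul_mul_assoc, x_mul_z, smul_add, smul_smul, inv_mul_cancel₀ hq', one_smul,
    smul_smul, smul_mul_assoc, one_mul, add_assoc, ← add_smul, neg_mul, mul_comm (γ : ℂ),
    add_neg_cancel, zero_smul, add_zero]

theorem zStar_pow_mul_x (hq : q ≠ 0) (n : ℕ) :
    𝐰 ^ n * (𝐳 * 𝐰) = aeval (𝐳 * 𝐰) (coneFactor q γ n) * 𝐰 ^ n := by
  induction n with
  | zero => simp [coneFactor_zero]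
  | succ n ih =>
    have h₁ := aeval_coneFactor_add_one (γ := γ) hq 0
    rw [zero_add, coneFactor_zero, aeval_X] at h₁
    rw [pow_succ, mul_assoc, zStar_mul_x hq, h₁, ← mul_assoc, mul_add, mul_smul_comm, ih,
      mul_smul_comm, mul_one, Nat.cast_succ, aeval_coneFactor_add_one hq]
    simp only [add_mul, smul_mul_assoc, one_mul, mul_assoc]

theorem z_pow_mul_x (hq : q ≠ 0) (n : ℕ) :
    𝐳 ^ n * (𝐳 * 𝐰) = aeval (𝐳 * 𝐰) (coneFactor q γ (-(n : ℤ))) * 𝐳 ^ n := by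
  induction n with
  | zero => simp [coneFactor_zero]
  | succ n ih =>
    have h₁ := aeval_coneFactor_sub_one (γ := γ) hq 0
    rw [zero_sub, coneFactor_zero, aeval_X] at h₁
    have : (-((n + 1 : ℕ) : ℤ)) = -(n : ℤ) - 1 := by push_cast; ring
    rw [pow_succ, mul_assoc (𝐳 ^ n), z_mul_x hq, h₁, ← mul_assoc, mul_add, mul_smul_comm, ih,
      mul_smul_comm, mul_one, this, aeval_coneFactor_sub_one hq]
    simp only [add_mul, smul_mul_assoc, one_mul, mul_assoc]

/-- The inner pair in `z ^ (n + 1) * w ^ (n + 1)` is `x`; moving it left past `z ^ n` turns it into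
the factor of index `-n`. -/
theorem z_pow_mul_zStar_pow (hq : q ≠ 0) (n : ℕ) :
    𝐳 ^ n * 𝐰 ^ n =
      aeval (𝐳 * 𝐰) (∏ l ∈ Finset.range n, coneFactor q γ (-(l : ℤ))) := by
  induction n with
  | zero => simp
  | succ n ih =>
    rw [Finset.prod_range_succ, mul_comm, map_mul, ← ih, ← mul_assoc, ← z_pow_mul_x hq]
    simp only [pow_succ 𝐳, pow_succ' 𝐰, mul_assoc]

theorem zStar_pow_mul_z_pow (hq : q ≠ 0) (n : ℕ) :
    𝐰 ^ n * 𝐳 ^ n =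
      aeval (𝐳 * 𝐰) (∏ l ∈ Finset.Icc 1 n, coneFactor q γ (l : ℤ)) := by
  induction n with
  | zero => simp
  | succ n ih =>
    have h₁ := aeval_coneFactor_add_one (γ := γ) hq 0
    rw [zero_add, coneFactor_zero, aeval_X] at h₁
    rw [Finset.prod_Icc_succ_top (by omega), mul_comm, map_mul, ← ih, Nat.cast_succ,
      aeval_coneFactor_add_one hq, add_mul, smul_mul_assoc, ← mul_assoc, ← zStar_pow_mul_x hq,
      smul_mul_assoc, one_mul, pow_succ 𝐰, pow_succ' 𝐳, mul_assoc, ← mul_assoc 𝐰, zStar_mul_z hq,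
      h₁, add_mul, mul_add, smul_mul_assoc, smul_mul_assoc, one_mul, mul_smul_comm, mul_smul_comm]
    simp only [mul_assoc]

theorem x_mul_z_pow (hq : q ≠ 0) (n : ℕ) :
    𝐳 * 𝐰 * 𝐳 ^ n = ((q ^ n : ℝ) : ℂ) • (𝐳 ^ n * (𝐳 * 𝐰)) + ((γ * qInt q n : ℝ) : ℂ) • 𝐳 ^ n := by
  induction n with
  | zero => simp [qInt_zero]
  | succ n ih =>
    rw [pow_succ, ← mul_assoc, ih, add_mul, smul_mul_assoc, smul_mul_assoc, mul_assoc (𝐳 ^ n),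
      x_mul_z, Nat.cast_succ, qInt_add_one' hq, mul_add (𝐳 ^ n), mul_smul_comm, mul_smul_comm,
      ← mul_assoc (𝐳 ^ n), zpow_natCast, pow_succ]
    push_cast
    module

/-! ### The strong grading -/

theorem z_pow_mem (N n : ℕ) : 𝐳 ^ n ∈ grading q γ N n := by
  simpa [genDeg] using SetLike.pow_mem_graded n (gen_mem q γ N DiscGen.z)

theorem zStar_pow_mem (N n : ℕ) : 𝐰 ^ n ∈ grading q γ N (-n) := by
  simpa [genDeg] using SetLike.pow_mem_graded n (gen_mem q γ N DiscGen.zStar)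

theorem x_mem (N : ℕ) : 𝐳 * 𝐰 ∈ grading q γ N 0 := by
  simpa [genDeg] using SetLike.mul_mem_graded (gen_mem q γ N DiscGen.z)
    (gen_mem q γ N DiscGen.zStar)

theorem aeval_x_mem (N : ℕ) (f : ℂ[X]) : aeval (𝐳 * 𝐰) f ∈ grading q γ N 0 := by
  have h := aeval_algHom_apply (degreeZero q γ N).val ⟨𝐳 * 𝐰, x_mem N⟩ f
  exact h ▸ (aeval (⟨𝐳 * 𝐰, x_mem N⟩ : degreeZero q γ N) f).2

theorem isStronglyGraded_grading (hq : q ≠ 0) (hγ : γ ≠ 0) {N : ℕ} (hN : 1 ≤ N)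
    (hq' : q = -1 → N ≤ 2) : IsStronglyGraded (grading q γ N) := by
  intro g
  have : NeZero N := ⟨by omega⟩
  obtain ⟨n, hn, rfl⟩ : ∃ n < N, (n : ZMod N) = g := ⟨g.val, g.val_lt, ZMod.natCast_zmod_val g⟩
  have hneg : ((N - n : ℕ) : ZMod N) = -n := by
    rw [Nat.cast_sub hn.le, ZMod.natCast_self, zero_sub]
  obtain ⟨r, s, hrs⟩ : IsCoprime (∏ l ∈ Finset.range n, coneFactor q γ (-(l : ℤ)))
      (∏ l ∈ Finset.Icc 1 (N - n), coneFactor q γ (l : ℤ)) := by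
    refine IsCoprime.prod_left fun l hl => IsCoprime.prod_right fun m hm => ?_
    rw [Finset.mem_range] at hl
    rw [Finset.mem_Icc] at hm
    exact isCoprime_coneFactor hγ (qInt_cross_ne hq hq' hm.1 (by omega))
  -- The Bézout coefficients `r`, `s` evaluated at `x` have degree 0, and `w ^ (N - n)` has degree
  -- `n` modulo `N`, so both left factors have degree `n`.
  refine ⟨2, ![aeval (𝐳 * 𝐰) r * 𝐳 ^ n, aeval (𝐳 * 𝐰) s * 𝐰 ^ (N - n)], ![𝐰 ^ n, 𝐳 ^ (N - n)],
    ?_, ?_, ?_⟩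
  · rw [Fin.forall_fin_two]
    constructor
    · simpa using SetLike.mul_mem_graded (aeval_x_mem N r) (z_pow_mem N n)
    · have h := SetLike.mul_mem_graded (aeval_x_mem N s)
        (zStar_pow_mem (q := q) (γ := γ) N (N - n))
      rwa [hneg, neg_neg, zero_add] at h
  · rw [Fin.forall_fin_two]
    refine ⟨zStar_pow_mem N n, ?_⟩
    have h := z_pow_mem (q := q) (γ := γ) N (N - n)
    rwa [hneg] at h
  · rw [Fin.sum_univ_two]
    change aeval (𝐳 * 𝐰) r * 𝐳 ^ n * 𝐰 ^ n + aeval (𝐳 * 𝐰) s * 𝐰 ^ (N - n) * 𝐳 ^ (N - n) = 1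
    rw [mul_assoc, mul_assoc, z_pow_mul_zStar_pow hq, zStar_pow_mul_z_pow hq, ← map_mul,
      ← map_mul, ← map_add, hrs, map_one]

/-! ### The representation on sequences indexed by the integers -/

/-- The action of the generators on sequences of polynomials indexed by the integers. -/
def shiftAction (q γ : ℝ) : DiscGen → Module.End ℂ (ℤ → ℂ[X])
  | DiscGen.z =>
    { toFun := fun f n => f (n - 1)
      map_add' := fun _ _ => rfl
      map_smul' := fun _ _ => rfl }
  | DiscGen.zStar =>
    { toFun := fun f n => coneFactor q γ (n + 1) * f (n + 1)
      map_add' := fun _ _ => funext fun _ => mul_add _ _ _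
      map_smul' := fun c f => funext fun n => mul_smul_comm c _ (f (n + 1)) }

/-- The representation of the quantum disc algebra in which `z` acts as a shift and `z z^*` acts by
multiplication with linear polynomials. -/
def shiftRep (hq : q ≠ 0) : QuantumDisc q γ →ₐ[ℂ] Module.End ℂ (ℤ → ℂ[X]) :=
  lift (shiftAction q γ) <| by
    refine LinearMap.ext fun f => funext fun n => ?_
    change coneFactor q γ (n + 1) * f (n + 1 - 1) =
      (q : ℂ) • (coneFactor q γ (n - 1 + 1) * f (n - 1 + 1)) + (γ : ℂ) • f n
    rw [add_sub_cancel_right, sub_add_cancel, coneFactor_add_one hq, smul_eq_C_mul, smul_eq_C_mul]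
    ring

theorem shiftRep_z (hq : q ≠ 0) (f : ℤ → ℂ[X]) (n : ℤ) : shiftRep hq 𝐳 f n = f (n - 1) := by
  rw [shiftRep, lift_gen]; rfl

theorem shiftRep_zStar (hq : q ≠ 0) (f : ℤ → ℂ[X]) (n : ℤ) :
    shiftRep hq 𝐰 f n = coneFactor q γ (n + 1) * f (n + 1) := by
  rw [shiftRep, lift_gen]; rfl

theorem shiftRep_aeval (hq : q ≠ 0) (g : ℂ[X]) (f : ℤ → ℂ[X]) (n : ℤ) :
    shiftRep hq (aeval (𝐳 * 𝐰) g) f n = g.comp (coneFactor q γ n) * f n := by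
  have hp : ∀ m : ℕ, shiftRep hq ((𝐳 * 𝐰) ^ m) f n = coneFactor q γ n ^ m * f n := by
    intro m
    induction m with
    | zero => simp
    | succ m ih =>
      rw [pow_succ', map_mul, map_mul, Module.End.mul_apply, Module.End.mul_apply, shiftRep_z,
        shiftRep_zStar, sub_add_cancel, ih, pow_succ', mul_assoc]
  induction g using Polynomial.induction_on' with
  | add g h hg hh =>
    rw [map_add, map_add, LinearMap.add_apply, Pi.add_apply, hg, hh, add_comp, add_mul]
  | monomial m c =>
    rw [aeval_monomial, ← Algebra.smul_def, map_smul, LinearMap.smul_apply, Pi.smul_apply, hp,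
      monomial_comp, smul_eq_C_mul, mul_assoc]

/-- Distinct Weyl powers send the basis vector at 0 to distinct positions with nonzero entries.
Polynomials in `x` act diagonally, so this separates the terms of a sum of `f(x) * weylPower n`. -/
theorem shiftRep_weylPower (hq : q ≠ 0) (m : ℤ) : ∃ g : ℂ[X], g ≠ 0 ∧
    ∀ n, shiftRep hq (weylPower 𝐳 𝐰 m) (Pi.single 0 1) n = if n = m then g else 0 := by
  cases m with
  | ofNat m =>
    refine ⟨1, one_ne_zero, ?_⟩
    change ∀ n, shiftRep hq (𝐳 ^ m) (Pi.single 0 1) n = _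
    induction m with
    | zero => intro n; simp [Pi.single_apply]
    | succ m ih =>
      intro n
      rw [pow_succ', map_mul, Module.End.mul_apply, shiftRep_z, ih]
      refine if_congr ?_ rfl rfl
      rw [Int.ofNat_eq_natCast, Int.ofNat_eq_natCast]
      omega
  | negSucc m =>
    have key : ∀ r : ℕ, ∃ g : ℂ[X], g ≠ 0 ∧
        ∀ n, shiftRep hq (𝐰 ^ r) (Pi.single 0 1) n = if n = -(r : ℤ) then g else 0 := by
      intro r
      induction r with
      | zero => exact ⟨1, one_ne_zero, fun n => by simp [Pi.single_apply]⟩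
      | succ r ih =>
        obtain ⟨g, hg, h⟩ := ih
        refine ⟨coneFactor q γ (-(r : ℤ)) * g, mul_ne_zero (coneFactor_ne_zero hq γ _) hg,
          fun n => ?_⟩
        rw [pow_succ', map_mul, Module.End.mul_apply, shiftRep_zStar, h]
        by_cases hn : n + 1 = -(r : ℤ)
        · rw [if_pos hn, if_pos (by push_cast; omega), hn]
        · rw [if_neg hn, if_neg (by push_cast; omega), mul_zero]
    exact key (m + 1)

/-! ### Normal form of words -/

theorem exists_word_eq (hq : q ≠ 0) (N : ℕ) (l : List DiscGen) : ∃ (f : ℂ[X]) (n : ℤ),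
    (l.map (gen q γ)).prod = aeval (𝐳 * 𝐰) f * weylPower 𝐳 𝐰 n ∧
      (n : ZMod N) = (l.map (genDeg N)).sum := by
  induction l with
  | nil => exact ⟨1, 0, by simp [weylPower], by simp⟩
  | cons x l ih =>
    obtain ⟨f, n, hf, hn⟩ := ih
    cases x with
    | z =>
      obtain ⟨g, hg⟩ := mul_aeval_mul_weylPower (p := X) (aeval_X _).symm (z_mul_x hq) f n
      exact ⟨g, n + 1, by rw [List.map_cons, List.prod_cons, hf, hg], by
        rw [List.map_cons, List.sum_cons, ← hn, genDeg]; push_cast; ring⟩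
    | zStar =>
      obtain ⟨g, hg⟩ := mul_aeval_mul_weylPower' (zStar_mul_z hq) (zStar_mul_x hq) f n
      exact ⟨g, n - 1, by rw [List.map_cons, List.prod_cons, hf, hg], by
        rw [List.map_cons, List.sum_cons, ← hn, genDeg]; push_cast; ring⟩

end QuantumDisc

namespace QuantumCone

variable {N : ℕ} {q γ : ℝ}

/-! ### The quantum cone as a generalized Weyl algebra -/

/-- The image of a generator in the quantum cone algebra. -/
def gen (N : ℕ) (q γ : ℝ) (x : ConeGen) : QuantumCone N q γ :=
  RingQuot.mkAlgHom ℂ (ConeRel N q γ) (FreeAlgebra.ι ℂ x)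

local notation "𝐚" => gen N q γ ConeGen.a
local notation "𝐛" => gen N q γ ConeGen.b
local notation "𝐜" => gen N q γ ConeGen.bStar

theorem a_mul_b : 𝐚 * 𝐛 = ((q ^ N : ℝ) : ℂ) • (𝐛 * 𝐚) + ((γ * qInt q N : ℝ) : ℂ) • 𝐛 := by
  have h := RingQuot.mkAlgHom_rel ℂ (ConeRel.a_b (N := N) (q := q) (γ := γ))
  rwa [map_mul, map_add, map_smul, map_smul, map_mul] at h

theorem bStar_mul_a : 𝐜 * 𝐚 = aeval 𝐚 (coneFactor q γ N) * 𝐜 := by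
  have h := RingQuot.mkAlgHom_rel ℂ (ConeRel.bStar_a (N := N) (q := q) (γ := γ))
  rw [map_mul, map_add, map_smul, map_smul, map_mul] at h
  rw [coneFactor, map_add, map_mul, aeval_C, aeval_C, aeval_X, add_mul, mul_assoc,
    ← Algebra.smul_def, ← Algebra.smul_def, zpow_natCast]
  exact h

theorem b_mul_bStar :
    𝐛 * 𝐜 = aeval 𝐚 (∏ l ∈ Finset.range N, coneFactor q γ (-(l : ℤ))) := by
  have h := RingQuot.mkAlgHom_rel ℂ (ConeRel.b_bStar (N := N) (q := q) (γ := γ))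
  rwa [map_mul, ← aeval_algHom_apply] at h

theorem bStar_mul_b :
    𝐜 * 𝐛 = aeval 𝐚 (∏ l ∈ Finset.Icc 1 N, coneFactor q γ (l : ℤ)) := by
  have h := RingQuot.mkAlgHom_rel ℂ (ConeRel.bStar_b (N := N) (q := q) (γ := γ))
  rwa [map_mul, ← aeval_algHom_apply] at h

theorem b_mul_a (hq : q ≠ 0) : 𝐛 * 𝐚 = aeval 𝐚 (C ((q ^ N : ℝ) : ℂ)⁻¹ * X +
    C (-(((q ^ N : ℝ) : ℂ)⁻¹ * ((γ * qInt q N : ℝ) : ℂ)))) * 𝐛 := by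
  have hq' : ((q ^ N : ℝ) : ℂ) ≠ 0 := Complex.ofReal_ne_zero.mpr (pow_ne_zero N hq)
  rw [map_add, map_mul, aeval_C, aeval_C, aeval_X, add_mul, mul_assoc, ← Algebra.smul_def,
    ← Algebra.smul_def, a_mul_b, smul_add, smul_smul, smul_smul, inv_mul_cancel₀ hq', one_smul,
    add_assoc, ← add_smul, add_neg_cancel, zero_smul, add_zero]

theorem range_weylSum (hq : q ≠ 0) : LinearMap.range (weylSum ℂ 𝐚 𝐛 𝐜) = ⊤ := by
  refine RingQuot.submodule_eq_top _
    ⟨Finsupp.single 0 1, by rw [weylSum_single]; simp [weylPower]⟩ fun x s hs => ?_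
  refine mul_mem_range_weylSum (fun f n => ?_) hs
  cases x with
  | a => exact ⟨X * f, n, by rw [map_mul, aeval_X, mul_assoc]; rfl⟩
  | b =>
    obtain ⟨g, hg⟩ := mul_aeval_mul_weylPower b_mul_bStar (b_mul_a hq) f n
    exact ⟨g, _, hg⟩
  | bStar =>
    obtain ⟨g, hg⟩ := mul_aeval_mul_weylPower' bStar_mul_b bStar_mul_a f n
    exact ⟨g, _, hg⟩

/-! ### The embedding into the quantum disc -/

local notation "𝐳" => QuantumDisc.gen q γ DiscGen.z
local notation "𝐰" => QuantumDisc.gen q γ DiscGen.zStar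

/-- The images `z z^*`, `z ^ N` and `(z^*) ^ N` of the generators of the quantum cone. -/
def discGen (N : ℕ) (q γ : ℝ) : ConeGen → QuantumDisc q γ
  | ConeGen.a => QuantumDisc.gen q γ DiscGen.z * QuantumDisc.gen q γ DiscGen.zStar
  | ConeGen.b => QuantumDisc.gen q γ DiscGen.z ^ N
  | ConeGen.bStar => QuantumDisc.gen q γ DiscGen.zStar ^ N

/-- The homomorphism from the quantum cone to the quantum disc. -/
def toDisc (N : ℕ) (γ : ℝ) (hq : q ≠ 0) : QuantumCone N q γ →ₐ[ℂ] QuantumDisc q γ :=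
  RingQuot.liftAlgHom ℂ ⟨FreeAlgebra.lift ℂ (discGen N q γ), by
    rintro _ _ (_ | _ | _ | _)
    · rw [map_mul, map_add, map_smul, map_smul, map_mul, FreeAlgebra.lift_ι_apply,
        FreeAlgebra.lift_ι_apply]
      exact QuantumDisc.x_mul_z_pow hq N
    · rw [map_mul, map_add, map_smul, map_smul, map_mul, FreeAlgebra.lift_ι_apply,
        FreeAlgebra.lift_ι_apply]
      refine (QuantumDisc.zStar_pow_mul_x hq N).trans ?_
      rw [coneFactor, map_add, map_mul, aeval_C, aeval_C, aeval_X, add_mul, mul_assoc,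
        ← Algebra.smul_def, ← Algebra.smul_def, zpow_natCast]
      rfl
    · rw [map_mul, ← aeval_algHom_apply, FreeAlgebra.lift_ι_apply, FreeAlgebra.lift_ι_apply,
        FreeAlgebra.lift_ι_apply]
      exact QuantumDisc.z_pow_mul_zStar_pow hq N
    · rw [map_mul, ← aeval_algHom_apply, FreeAlgebra.lift_ι_apply, FreeAlgebra.lift_ι_apply,
        FreeAlgebra.lift_ι_apply]
      exact QuantumDisc.zStar_pow_mul_z_pow hq N⟩

theorem toDisc_gen (hq : q ≠ 0) (x : ConeGen) : toDisc N γ hq (gen N q γ x) = discGen N q γ x := by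
  unfold toDisc gen
  rw [RingQuot.liftAlgHom_mkAlgHom_apply, FreeAlgebra.lift_ι_apply]

theorem toDisc_aeval_mul_weylPower (hq : q ≠ 0) (hN : 1 ≤ N) (f : ℂ[X]) (n : ℤ) :
    toDisc N γ hq (aeval 𝐚 f * weylPower 𝐛 𝐜 n) =
      aeval (𝐳 * 𝐰) f * weylPower 𝐳 𝐰 (N * n) := by
  rw [map_mul, ← aeval_algHom_apply, map_weylPower, toDisc_gen, toDisc_gen, toDisc_gen,
    weylPower_mul _ _ _ _ hN]
  rfl

/-- Position `N * m` of the image vector depends only on the coefficient `F m`, composed with a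
linear polynomial and multiplied by a nonzero one. -/
theorem toDisc_injective (hq : q ≠ 0) (hN : 1 ≤ N) : Function.Injective (toDisc N γ hq) := by
  have hinj : ∀ F : ℤ →₀ ℂ[X], toDisc N γ hq (weylSum ℂ 𝐚 𝐛 𝐜 F) = 0 → F = 0 := by
    intro F hF
    choose g hg hρ using QuantumDisc.shiftRep_weylPower (γ := γ) hq
    have hcoef : ∀ (F : ℤ →₀ ℂ[X]) (m : ℤ),
        QuantumDisc.shiftRep hq (toDisc N γ hq (weylSum ℂ 𝐚 𝐛 𝐜 F)) (Pi.single 0 1) (N * m) =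
          (F m).comp (coneFactor q γ (N * m)) * g (N * m) := by
      intro F m
      induction F using Finsupp.induction_linear with
      | zero => simp
      | add F G hF hG =>
        rw [map_add, map_add, map_add, LinearMap.add_apply, Pi.add_apply, hF, hG,
          Finsupp.add_apply, add_comp, add_mul]
      | single n f =>
        rw [weylSum_single, toDisc_aeval_mul_weylPower hq hN, map_mul, Module.End.mul_apply,
          QuantumDisc.shiftRep_aeval, hρ]
        by_cases h : m = n
        · subst h
          rw [if_pos rfl, Finsupp.single_eq_same]
        · have hne : (N : ℤ) * m ≠ N * n := fun h' =>
            h (mul_left_cancel₀ (by exact_mod_cast (by omega : N ≠ 0)) h')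
          rw [if_neg hne, Finsupp.single_eq_of_ne h, mul_zero, zero_comp, zero_mul]
    ext1 m
    have h := hcoef F m
    rw [hF, map_zero, LinearMap.zero_apply, Pi.zero_apply, eq_comm, mul_eq_zero,
      or_iff_left (hg _)] at h
    -- A composite vanishes only if the outer polynomial is zero or the inner one is constant; the
    -- inner one has degree 1.
    rcases comp_eq_zero_iff.mp h with h | ⟨-, h⟩
    · exact h
    · have hd := natDegree_coneFactor hq γ (N * m)
      rw [h, natDegree_C] at hd
      omega
  intro x y hxy
  obtain ⟨F, rfl⟩ := LinearMap.range_eq_top.mp (range_weylSum hq) x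
  obtain ⟨G, rfl⟩ := LinearMap.range_eq_top.mp (range_weylSum hq) y
  rw [sub_eq_zero.mp (hinj (F - G) ?_)]
  rw [map_sub, map_sub, hxy, sub_self]

/-- A word of degree 0 has the form `f(x) * weylPower n` with `N ∣ n`, and such a power of `z` or
`w` is a power of the image of `b` or `b^*`. -/
theorem mem_degreeZero_iff (hq : q ≠ 0) (hN : 1 ≤ N) (d : QuantumDisc q γ) :
    d ∈ QuantumDisc.grading q γ N 0 ↔ ∃ c, toDisc N γ hq c = d := by
  constructor
  · intro hd
    change d ∈ LinearMap.range (toDisc N γ hq).toLinearMap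
    refine Submodule.span_le.mpr ?_ hd
    rintro _ ⟨l, hl, rfl⟩
    obtain ⟨f, n, hf, hn⟩ := QuantumDisc.exists_word_eq (q := q) (γ := γ) hq N l
    rw [hl, ZMod.intCast_zmod_eq_zero_iff_dvd] at hn
    obtain ⟨m, rfl⟩ := hn
    exact ⟨_, (toDisc_aeval_mul_weylPower hq hN f m).trans hf.symm⟩
  · rintro ⟨c, rfl⟩
    have hgen : ∀ x, discGen N q γ x ∈ QuantumDisc.grading q γ N 0 := by
      rintro (_ | _ | _)
      · exact QuantumDisc.x_mem N
      · simpa [discGen] using QuantumDisc.z_pow_mem (q := q) (γ := γ) N N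
      · simpa [discGen] using QuantumDisc.zStar_pow_mem (q := q) (γ := γ) N N
    have htop : (QuantumDisc.grading q γ N 0).comap (toDisc N γ hq).toLinearMap = ⊤ := by
      refine RingQuot.submodule_eq_top _ ?_ fun x s hs => ?_
      · change toDisc N γ hq 1 ∈ QuantumDisc.grading q γ N 0
        rw [map_one]
        exact SetLike.one_mem_graded _
      · change toDisc N γ hq (gen N q γ x * s) ∈ QuantumDisc.grading q γ N 0
        rw [map_mul, toDisc_gen]
        have h := SetLike.mul_mem_graded (hgen x) hs
        rwa [add_zero] at h
    exact (htop ▸ Submodule.mem_top : c ∈ (QuantumDisc.grading q γ N 0).comap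
      (toDisc N γ hq).toLinearMap)

end QuantumCone

/-! ### Smoothness of both models of the cone -/

theorem QuantumDisc.isHomologicallySmooth_of_range_eq {q γ : ℝ} (hq : q ≠ 0) (hγ : γ ≠ 0) {N : ℕ}
    (hN : 1 ≤ N) (hq' : q = -1 → N ≤ 2) {B : Type} [Ring B] [Algebra ℂ B]
    (ι : B →ₐ[ℂ] QuantumDisc q γ) (hι : Function.Injective ι)
    (hrange : ∀ d, d ∈ grading q γ N 0 ↔ ∃ b, ι b = d) : IsHomologicallySmooth ℂ B := by
  have : NeZero N := ⟨by omega⟩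
  let κ : QuantumDisc q γ →ₗ[ℂ] ℕ → ℂ[X] :=
    (LinearMap.applyₗ (Pi.single 0 1)) ∘ₗ (normalRep q γ).toLinearMap
  exact IsStronglyGraded.isHomologicallySmooth (κ := κ) (gen_rel q γ) span_normal_monomials
    normalRep_monomial (grading q γ N) (isStronglyGraded_grading hq hγ hN hq') (g := 1)
    (gen_mem q γ N DiscGen.z) (gen_mem q γ N DiscGen.zStar) ι hι hrange

end

theorem theorem1 (q γ : ℝ) (hq : q ≠ 0) (hγ : γ ≠ 0) (N : ℕ) (hN : 1 ≤ N)
    (hq' : q = -1 → N ≤ 2) :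
    IsStronglyGraded (QuantumDisc.grading q γ N) ∧
      (1 < N →
        IsHomologicallySmooth ℂ (QuantumDisc.degreeZero q γ N) ∧
        IsHomologicallySmooth ℂ (QuantumCone N q γ)) := by
  refine ⟨QuantumDisc.isStronglyGraded_grading hq hγ hN hq', fun _ => ⟨?_, ?_⟩⟩
  · exact QuantumDisc.isHomologicallySmooth_of_range_eq hq hγ hN hq'
      (QuantumDisc.degreeZero q γ N).val Subtype.val_injective
      fun d => ⟨fun h => ⟨⟨d, h⟩, rfl⟩, fun ⟨b, hb⟩ => hb ▸ b.2⟩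
  · exact QuantumDisc.isHomologicallySmooth_of_range_eq hq hγ hN hq'
      (QuantumCone.toDisc N γ hq) (QuantumCone.toDisc_injective hq hN)
      (QuantumCone.mem_degreeZero_iff hq hN)
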